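/- An election consists of a finite set $\mathcal C$ of $m\ge 1$ candidates, a finite set $\mathcal V$ of $n\ge 1$ voters, a profile $(\succ_i)_{i\in\mathcal V}$ of linear orders over $\mathcal C$, and a tie-breaking linear order $\succ_t$ over $\mathcal C$. The (simplified) Bucklin score of a candidate $c$ is the least $l$ such that at least half of the voters rank $c$ among their top $l$ positions; the Bucklin voting rule $r$ selects, among the candidates with lowest Bucklin score, the one ranked highest by $\succ_t$. Let $x=r((\succ_i)_{i\in\mathcal V})$ be the current winner. A set $M\subseteq\mathcal V$ is a coalition of possible manipulators against a candidate $y\ne x$ if there are linear orders $(\succ'_j)_{j\in M}$ over $\mathcal C$ with $x\succ'_j y$ for all $j\in M$ and $r\big((\succ_j)_{j\in\mathcal V\setminus M},(\succ'_j)_{j\in M}\big)=y$; it is a coalition of possible manipulators if it is one against some $y \neq x$. Consider the following decision problems for the Bucklin voting rule, whose input always contains an election: - CPMW: given also $M\subseteq\mathcal V$ and $y\in\mathcal C$, is $M$ a coalition of possible manipulators against $y$? - CPM: given also $M\subseteq\mathcal V$, is $M$ a coalition of possible manipulators? - CPMSW: given also $y\in\mathcal C$ and $k\in\mathbb N$,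 is there a coalition $M\subseteq\mathcal V$ with $|M|\le k$ of possible manipulators against $y$? - CPMS: given also $k\in\mathbb N$, is there a coalition $M\subseteq\mathcal V$ with $|M|\le k$ of possible manipulators? **Theorem.** CPMW and CPM for the Bucklin voting rule are in $\mathsf P$ (with no restriction on $|M|$). For every constant $K$, CPMSW and CPMS for the Bucklin voting rule, restricted to instances with $k\le K$, are in $\mathsf P$. -/

import Mathlib

namespace PossibleManipulators

/-! ### Preferences, voting rules and the Bucklin rule -/

/-- A preference (linear order) over the candidates `Fin m`, written as its ranking from best to
worst: `p j` is the candidate at position `j` (positions are counted from `0`), so `p.symm c` is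
the position of the candidate `c`. -/
abbrev Preference (m : ℕ) : Type := Equiv.Perm (Fin m)

/-- `p.Prefers a b`: the preference `p` ranks `a` strictly above `b`. -/
def Preference.Prefers {m : ℕ} (p : Preference m) (a b : Fin m) : Prop :=
  p.symm a < p.symm b

/-- A preference profile of the voters `Fin n`. -/
abbrev Profile (m n : ℕ) : Type := Fin n → Preference m

/-- A voting rule with lexicographic tie breaking: for every number `m ≥ 1` of candidates, every
number `n` of voters and every tie-breaking preference, it selects one winner of each profile. -/
abbrev VotingRule : Type :=
  ∀ (m n : ℕ) [NeZero m], Preference m → Profile m n → Fin m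

/-- The lexicographic tie-breaking rule of the preference `t`: it selects the candidate of `S`
that `t` ranks highest. -/
def lexTieBreak {m : ℕ} (t : Preference m) (S : Finset (Fin m)) (hS : S.Nonempty) : Fin m :=
  t ((S.image t.symm).min' (hS.image t.symm))

/-- The number of voters that rank `c` in their top `l` positions. -/
def topCount {m n : ℕ} (V : Profile m n) (c : Fin m) (l : ℕ) : ℕ :=
  (Finset.univ.filter fun i : Fin n => ((V i).symm c : ℕ) < l).card

/-- The (simplified) Bucklin score: the least `l` such that at least half of the voters rank `c`
in their top `l` positions. -/
noncomputable def bucklinScore {m n : ℕ} (V : Profile m n) (c : Fin m) : ℕ :=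
  sInf {l : ℕ | n ≤ 2 * topCount V c l}

/-- The Bucklin voting correspondence: the candidates with lowest Bucklin score. -/
noncomputable def bucklinWinners {m n : ℕ} (V : Profile m n) : Finset (Fin m) :=
  Finset.univ.filter fun c => ∀ d, bucklinScore V c ≤ bucklinScore V d

theorem bucklinWinners_nonempty {m n : ℕ} [NeZero m] (V : Profile m n) :
    (bucklinWinners V).Nonempty := by
  obtain ⟨c, -, hc⟩ := Finset.exists_min_image Finset.univ (bucklinScore V) ⟨0, Finset.mem_univ _⟩
  exact ⟨c, by simpa [bucklinWinners] using hc⟩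

/-- The Bucklin voting rule. -/
noncomputable def bucklin : VotingRule :=
  fun _ _ _ t V => lexTieBreak t (bucklinWinners V) (bucklinWinners_nonempty V)

/-! ### Coalitions of possible manipulators -/

/-- `M` is a coalition of possible manipulators against `y` in the profile `V`, for the voting rule
`r` on `m` candidates and `n` voters: `y` differs from the current winner `r V`, and the members of
`M` can replace their votes by preferences that all rank the current winner above `y`, so that `y`
wins. (`M.piecewise W V` takes the votes of `M` from `W` and all others from `V`.) -/
def IsPossibleCoalitionAgainst {m n : ℕ} (r : Profile m n → Fin m) (V : Profile m n)
    (M : Finset (Fin n)) (y : Fin m) : Prop :=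
  y ≠ r V ∧ ∃ W : Profile m n, (∀ j ∈ M, (W j).Prefers (r V) y) ∧ r (M.piecewise W V) = y

/-- `M` is a coalition of possible manipulators. -/
def IsPossibleCoalition {m n : ℕ} (r : Profile m n → Fin m) (V : Profile m n)
    (M : Finset (Fin n)) : Prop :=
  ∃ y, IsPossibleCoalitionAgainst r V M y

/-! ### Elections and their encoding as strings -/

/-- An election: at least one candidate, at least one voter, the tie-breaking preference and the
reported votes. -/
structure Election where
  /-- number of candidates -/
  numCand : ℕ
  /-- number of voters -/
  numVoters : ℕ
  candNe : NeZero numCand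
  votersNe : NeZero numVoters
  /-- the tie-breaking preference -/
  tie : Preference numCand
  /-- the reported votes -/
  votes : Profile numCand numVoters

attribute [instance] Election.candNe Election.votersNe

/-- The voting rule `r` on the candidates and voters of the election `E`. -/
def Election.rule (r : VotingRule) (E : Election) :
    Profile E.numCand E.numVoters → Fin E.numCand :=
  r E.numCand E.numVoters E.tie

open Computability

/-- A candidate is written as its index in unary, followed by a comma. A single vote lists all `m`
candidates, so compared with binary indices the length changes only polynomially. -/
def encodeCandidate {m : ℕ} (c : Fin m) : List Γ' :=
  List.replicate (c : ℕ) (Γ'.bit true) ++ [Γ'.comma]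

/-- A preference is written as the bracketed list of the candidates from best to worst. -/
def encodePreference {m : ℕ} (p : Preference m) : List Γ' :=
  Γ'.bra :: ((List.ofFn fun j => encodeCandidate (p j)).flatten ++ [Γ'.ket])

/-- An election is written as the tie-breaking preference followed by all the votes. -/
def encodeElection (E : Election) : List Γ' :=
  encodePreference E.tie ++ (List.ofFn fun i => encodePreference (E.votes i)).flatten

/-- A set of voters is written as the bit string of its indicator function. -/
def encodeCoalition {n : ℕ} (M : Finset (Fin n)) : List Γ' :=
  List.ofFn fun i => Γ'.bit (decide (i ∈ M))

/-- A natural number is written in binary. -/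
def encodeNumber (k : ℕ) : List Γ' :=
  (encodeNat k).map Γ'.bit

/-! ### The four decision problems, as languages of encoded yes-instances -/

/-- CPMW: given an election, a set `M` of voters and a candidate `y`, is `M` a coalition of
possible manipulators against `y`? -/
def CPMW (r : VotingRule) : Language Γ' :=
  {w | ∃ (E : Election) (M : Finset (Fin E.numVoters)) (y : Fin E.numCand),
    w = encodeElection E ++ encodeCoalition M ++ [Γ'.comma] ++ encodeCandidate y ∧
    IsPossibleCoalitionAgainst (E.rule r) E.votes M y}

/-- CPM: given an election and a set `M` of voters, is `M` a coalition of possible manipulators? -/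
def CPM (r : VotingRule) : Language Γ' :=
  {w | ∃ (E : Election) (M : Finset (Fin E.numVoters)),
    w = encodeElection E ++ encodeCoalition M ∧
    IsPossibleCoalition (E.rule r) E.votes M}

/-- CPMSW restricted to instances whose maximum coalition size `k` is at most the constant `K`:
given an election, a candidate `y` and a number `k`, is there a coalition of at most `k` possible
manipulators against `y`? -/
def CPMSW (r : VotingRule) (K : ℕ) : Language Γ' :=
  {w | ∃ (E : Election) (y : Fin E.numCand) (k : ℕ), k ≤ K ∧
    w = encodeElection E ++ encodeCandidate y ++ encodeNumber k ∧
    ∃ M : Finset (Fin E.numVoters), M.card ≤ k ∧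
      IsPossibleCoalitionAgainst (E.rule r) E.votes M y}

/-- CPMS restricted to instances whose maximum coalition size `k` is at most the constant `K`:
given an election and a number `k`, is there a coalition of at most `k` possible manipulators? -/
def CPMS (r : VotingRule) (K : ℕ) : Language Γ' :=
  {w | ∃ (E : Election) (k : ℕ), k ≤ K ∧
    w = encodeElection E ++ encodeNumber k ∧
    ∃ M : Finset (Fin E.numVoters), M.card ≤ k ∧
      IsPossibleCoalition (E.rule r) E.votes M}

open Classical in
/-- The complexity class `P`: some multi-stack Turing machine decides membership in the language,
on every input string, within a number of steps polynomial in the length of the string. -/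
def InP {Γ : Type} (L : Language Γ) : Prop :=
  Nonempty (Turing.TM2ComputableInPolyTime (fun w : List Γ => w) encodeBool
    (fun w => decide (w ∈ L)))

end PossibleManipulators

/-!
Both parts of the proof are about words. On the machine side, arithmetic expressions with bounded
sums over the input word are compiled to programs acting on unary stacks, and these to multi-stack
Turing machines. The value of an expression is polynomially bounded in the length of the word, so
unary arithmetic costs only polynomial time, and every language whose indicator function is given
by such an expression is in `P`.

On the voting side, fix a coalition `M` against `y`. Suppose that `y` is to win with score `l + 1`,
and that `τ` of the manipulators put `y` in their top `l + 1` positions; as these also rank the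
current winner `x` above `y`, they support `x` as well. What remains is to distribute the other
candidates over the top positions so that none is supported too often. Positions can be dealt out
cyclically, so the votes of the manipulators matter only through the numbers `U` and `U'` of places
that the two groups of manipulators give to the candidates losing a tie against `y`, and the
distribution exists if and only if finitely many inequalities between sums of minima hold. The
numbers `l`, `τ`, `U`, `U'` are polynomially bounded, hence quantification over them is definable
by an expression. If the size of the coalition is bounded by a constant, then so is the number of
quantifiers that choose its members.
-/

namespace PossibleManipulators

open Computability Turing

/-! ### Stack programs and Turing machines -/

section Compilation

variable {Γ Λ : Type}

/-- Programs acting on stacks with symbols in `Γ`, indexed by `ℕ`: the intermediate language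
between arithmetic expressions and multi-stack Turing machines. `move j k` pops a symbol from the
stack `j`, if there is one, and pushes it on the stack `k`; `loop k p` repeats `p` until the stack
`k` is empty. -/
inductive Prog (Γ : Type) : Type
  | skip : Prog Γ
  | push (k : ℕ) (a : Γ) : Prog Γ
  | drop (k : ℕ) : Prog Γ
  | move (j k : ℕ) : Prog Γ
  | seq (p q : Prog Γ) : Prog Γ
  | ifHead (k : ℕ) (a : Γ) (p q : Prog Γ) : Prog Γ
  | loop (k : ℕ) (p : Prog Γ) : Prog Γ

/-- The contents of all stacks of a program, each listed from its top. -/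
abbrev Store (Γ : Type) : Type := ℕ → List Γ

namespace Store

open Function

/-- The store whose only possibly nonempty stack is `l`, at index `r`. -/
def single (r : ℕ) (l : List Γ) : Store Γ := update (fun _ => []) r l

@[simp]
theorem single_self (r : ℕ) (l : List Γ) : single r l r = l := update_self ..

theorem single_of_ne {k r : ℕ} (h : k ≠ r) (l : List Γ) : single r l k = [] := update_of_ne h ..

@[simp]
theorem single_nil (r : ℕ) : single r ([] : List Γ) = fun _ => [] := update_eq_self r _

@[simp]
theorem update_single (r : ℕ) (l l' : List Γ) : update (single r l) r l' = single r l' :=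
  update_idem ..

end Store

namespace Prog

open Function

/-- Big-step semantics with time bounds: `Runs p S S' T` says that `p` turns the store `S` into `S'`
in at most `T` steps. -/
inductive Runs : Prog Γ → Store Γ → Store Γ → ℕ → Prop
  | skip (S : Store Γ) : Runs skip S S 1
  | push (k : ℕ) (a : Γ) (S : Store Γ) : Runs (push k a) S (update S k (a :: S k)) 1
  | drop (k : ℕ) (S : Store Γ) : Runs (drop k) S (update S k (S k).tail) 1
  | move (j k : ℕ) (S : Store Γ) : Runs (move j k) S
      (update (update S j (S j).tail) k ((S j).head?.toList ++ update S j (S j).tail k)) 1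
  | seq {p q : Prog Γ} {S S' S'' : Store Γ} {T T' : ℕ} (h : Runs p S S' T)
      (h' : Runs q S' S'' T') : Runs (seq p q) S S'' (T + T')
  | if_pos {k : ℕ} {a : Γ} {p q : Prog Γ} {S S' : Store Γ} {T : ℕ} (hk : (S k).head? = some a)
      (h : Runs p S S' T) : Runs (ifHead k a p q) S S' (T + 1)
  | if_neg {k : ℕ} {a : Γ} {p q : Prog Γ} {S S' : Store Γ} {T : ℕ} (hk : (S k).head? ≠ some a)
      (h : Runs q S S' T) : Runs (ifHead k a p q) S S' (T + 1)
  | loop_nil {k : ℕ} {p : Prog Γ} {S : Store Γ} (hk : S k = []) : Runs (loop k p) S S 1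
  | loop_cons {k : ℕ} {p : Prog Γ} {S S' S'' : Store Γ} {T T' : ℕ} (hk : S k ≠ [])
      (h : Runs p S S' T) (h' : Runs (loop k p) S' S'' T') : Runs (loop k p) S S'' (T + T' + 1)
  | mono {p : Prog Γ} {S S' : Store Γ} {T T' : ℕ} (h : Runs p S S' T) (hT : T ≤ T') :
      Runs p S S' T'

/-- A number of stacks that suffices to run a program: all indices of its stacks lie below. -/
@[reducible]
def numStacks : Prog Γ → ℕ
  | skip => 0
  | push k _ => k + 1
  | drop k => k + 1
  | move j k => max (j + 1) (k + 1)
  | seq p q => max p.numStacks q.numStacks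
  | ifHead k _ p q => max (k + 1) (max p.numStacks q.numStacks)
  | loop k p => max (k + 1) p.numStacks

/-- The labels of a compiled program: one for each instruction, and one for each test. -/
@[reducible]
def Label : Prog Γ → Type
  | seq p q => Label p ⊕ Label q
  | ifHead _ _ p q => Option (Label p ⊕ Label q)
  | loop _ p => Option (Label p)
  | _ => Unit

instance instFintypeLabel : ∀ p : Prog Γ, Fintype (Label p)
  | seq p q =>
    haveI := instFintypeLabel p; haveI := instFintypeLabel q
    inferInstanceAs (Fintype (Label p ⊕ Label q))
  | ifHead _ _ p q =>
    haveI := instFintypeLabel p; haveI := instFintypeLabel q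
    inferInstanceAs (Fintype (Option (Label p ⊕ Label q)))
  | loop _ p =>
    haveI := instFintypeLabel p
    inferInstanceAs (Fintype (Option (Label p)))
  | skip | push _ _ | drop _ | move _ _ => inferInstanceAs (Fintype Unit)

/-- The label at which a compiled program starts. -/
def entry : ∀ p : Prog Γ, Label p
  | seq p _ => Sum.inl (entry p)
  | ifHead _ _ _ _ => none
  | loop _ _ => none
  | skip | push _ _ | drop _ | move _ _ => ()

/-- The alphabets of the stacks of a compiled program: an output stack over `Bool`, with index
`none`, and `N` work stacks over `Γ`. -/
@[reducible]
def StackAlphabet (Γ : Type) (N : ℕ) : Option (Fin N) → Type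
  | none => Bool
  | some _ => Γ

/-- The contents of the stacks of a machine: `o` on the output stack, and the first `N` stacks of a
store on the work stacks. -/
def toStacks (N : ℕ) (o : List Bool) (S : Store Γ) : ∀ k, List (StackAlphabet Γ N k)
  | none => o
  | some i => S i

theorem update_toStacks_some {N : ℕ} (o : List Bool) (S : Store Γ) (k : Fin N) (l : List Γ) :
    update (toStacks N o S) (some k) l = toStacks N o (update S k l) := by
  funext i
  rcases i with _ | i
  · exact update_of_ne (by simp) ..
  · obtain rfl | h := eq_or_ne i k
    · simp [toStacks]
    · rw [update_of_ne (by simpa using h)]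
      simp [toStacks, update_of_ne (Fin.val_injective.ne h)]

theorem update_toStacks_none (N : ℕ) (o o' : List Bool) (S : Store Γ) :
    update (toStacks N o S) none o' = toStacks N o' S := by
  funext i
  rcases i with _ | i
  · exact update_self ..
  · exact update_of_ne (by simp) ..

/-- A statement of a machine with the stacks of a compiled program; its internal state is the symbol
read last. -/
abbrev MachineStmt (Γ Λ : Type) (N : ℕ) : Type := TM2.Stmt (StackAlphabet Γ N) Λ (Option Γ)

section Simulation

variable {N : ℕ} {m : Λ → MachineStmt Γ Λ N} {o : List Bool} {l l' l'' : Λ} {S S' S'' : Store Γ}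
  {T T' : ℕ}

/-- From the label `l` with the store `S`, the machine `m` reaches the label `l'` with the store
`S'` in at most `T` steps, whatever symbol was read last. -/
def Reaches (m : Λ → MachineStmt Γ Λ N) (o : List Bool) (l l' : Λ) (S S' : Store Γ) (T : ℕ) :
    Prop :=
  ∀ v, ∃ v', Nonempty (StateTransition.EvalsToInTime (TM2.step m) ⟨some l, v, toStacks N o S⟩
    (some ⟨some l', v', toStacks N o S'⟩) T)

theorem Reaches.of_stepAux
    (h : ∀ v, ∃ v', TM2.stepAux (m l) v (toStacks N o S) = ⟨some l', v', toStacks N o S'⟩) :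
    Reaches m o l l' S S' 1 := fun v =>
  let ⟨v', hv'⟩ := h v
  ⟨v', ⟨⟨1, congrArg some hv'⟩, le_rfl⟩⟩

theorem Reaches.trans (h : Reaches m o l l' S S' T) (h' : Reaches m o l' l'' S' S'' T') :
    Reaches m o l l'' S S'' (T + T') := fun v => by
  obtain ⟨v', ⟨h⟩⟩ := h v
  obtain ⟨v'', ⟨h'⟩⟩ := h' v'
  exact ⟨v'', ⟨Nat.add_comm T' T ▸ h.trans _ _ _ _ _ _ h'⟩⟩

theorem Reaches.mono (h : Reaches m o l l' S S' T) (hT : T ≤ T') : Reaches m o l l' S S' T' :=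
  fun v => let ⟨v', ⟨h⟩⟩ := h v
  ⟨v', ⟨⟨h.toEvalsTo, h.steps_le_m.trans hT⟩⟩⟩

end Simulation

/-- The last statement of a machine: it answers whether the stack `r` is nonempty. -/
def answer {N : ℕ} (r : Fin N) : MachineStmt Γ Λ N :=
  .pop (some r) (fun _ a => a)
    (.push none (fun v => (v.isSome : Bool)) (.load (fun _ => none) .halt))

theorem stepAux_answer {N : ℕ} (r : Fin N) (v : Option Γ) (S : Store Γ) :
    TM2.stepAux (answer (Λ := Λ) r) v (toStacks N [] S) =
      ⟨none, none, toStacks N [(S r).head?.isSome] (update S r (S r).tail)⟩ := by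
  simp only [answer, TM2.stepAux]
  rw [update_toStacks_some]
  exact congrArg (TM2.Cfg.mk _ _) (update_toStacks_none ..)

variable [DecidableEq Γ] [Inhabited Γ]

/-- The code of a program at each of its labels, when its labels are embedded into `Λ` by `emb` and
the computation continues at the label `exit`. -/
def code {N : ℕ} : ∀ p : Prog Γ, p.numStacks ≤ N → (Label p → Λ) → Λ → Label p → MachineStmt Γ Λ N
  | skip, _, _, exit, _ => .goto fun _ => exit
  | push k a, hk, _, exit, _ => .push (some ⟨k, hk⟩) (fun _ => a) (.goto fun _ => exit)
  | drop k, hk, _, exit, _ => .pop (some ⟨k, hk⟩) (fun v _ => v) (.goto fun _ => exit)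
  | move j k, h, _, exit, _ => .pop (some ⟨j, (max_le_iff.1 h).1⟩) (fun _ a => a)
      (.branch Option.isSome (.push (some ⟨k, (max_le_iff.1 h).2⟩)
        (fun v => (v.getD default : Γ)) (.goto fun _ => exit)) (.goto fun _ => exit))
  | seq p q, h, emb, exit, l => Sum.elim
      (code p (max_le_iff.1 h).1 (emb ∘ Sum.inl) (emb (Sum.inr (entry q))))
      (code q (max_le_iff.1 h).2 (emb ∘ Sum.inr) exit) l
  | ifHead k a p q, h, emb, exit, l => Option.elim l
      (.peek (some ⟨k, (max_le_iff.1 h).1⟩) (fun _ b => b) (.goto fun v =>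
        if v = some a then emb (some (Sum.inl (entry p))) else emb (some (Sum.inr (entry q)))))
      (Sum.elim
        (code p (max_le_iff.1 (max_le_iff.1 h).2).1 (emb ∘ some ∘ Sum.inl) exit)
        (code q (max_le_iff.1 (max_le_iff.1 h).2).2 (emb ∘ some ∘ Sum.inr) exit))
  | loop k p, h, emb, exit, l => Option.elim l
      (.peek (some ⟨k, (max_le_iff.1 h).1⟩) (fun _ b => b) (.goto fun v =>
        if v.isSome then emb (some (entry p)) else exit))
      (code p (max_le_iff.1 h).2 (emb ∘ some) (emb none))

theorem reaches_move {N : ℕ} (m : Λ → MachineStmt Γ Λ N) (o : List Bool) {j k : ℕ}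
    (h : (move j k : Prog Γ).numStacks ≤ N) {emb : Unit → Λ} {exit : Λ}
    (hm : m (emb ()) = code (move j k) h emb exit ()) (S : Store Γ) :
    Reaches m o (emb ()) exit S
      (update (update S j (S j).tail) k ((S j).head?.toList ++ update S j (S j).tail k)) 1 := by
  refine .of_stepAux fun v => ⟨(S j).head?, ?_⟩
  have hj : toStacks N o S (some ⟨j, (max_le_iff.1 h).1⟩) = S j := rfl
  simp only [hm, code, TM2.stepAux]
  rw [hj, update_toStacks_some]
  cases (S j).head? with
  | none => simp
  | some a => exact congrArg (TM2.Cfg.mk _ _) (update_toStacks_some ..)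

theorem reaches_ifHead {N : ℕ} (m : Λ → MachineStmt Γ Λ N) (o : List Bool) {k : ℕ} {a : Γ}
    {p q : Prog Γ} (h : (ifHead k a p q).numStacks ≤ N) {emb : Label (ifHead k a p q) → Λ}
    {exit : Λ} (hm : m (emb none) = code (ifHead k a p q) h emb exit none) (S : Store Γ) :
    Reaches m o (emb none) (if (S k).head? = some a then emb (some (Sum.inl (entry p)))
      else emb (some (Sum.inr (entry q)))) S S 1 :=
  .of_stepAux fun _ => ⟨(S k).head?, by rw [hm]; rfl⟩

theorem reaches_loop {N : ℕ} (m : Λ → MachineStmt Γ Λ N) (o : List Bool) {k : ℕ} {p : Prog Γ}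
    (h : (loop k p).numStacks ≤ N) {emb : Label (loop k p) → Λ} {exit : Λ}
    (hm : m (emb none) = code (loop k p) h emb exit none) (S : Store Γ) :
    Reaches m o (emb none) (if (S k).head?.isSome then emb (some (entry p)) else exit) S S 1 :=
  .of_stepAux fun _ => ⟨(S k).head?, by rw [hm]; rfl⟩

theorem Runs.reaches {N : ℕ} (m : Λ → MachineStmt Γ Λ N) (o : List Bool) {p : Prog Γ}
    {S S' : Store Γ} {T : ℕ} (hr : Runs p S S' T) :
    ∀ (h : p.numStacks ≤ N) (emb : Label p → Λ) (exit : Λ), (∀ l, m (emb l) = code p h emb exit l) →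
      Reaches m o (emb (entry p)) exit S S' T := by
  induction hr with
  | skip S => exact fun _ _ _ hm => .of_stepAux fun v => ⟨v, by rw [hm]; rfl⟩
  | push k a S =>
    exact fun h _ _ hm => .of_stepAux fun v => ⟨v, by
      rw [hm]; exact congrArg (TM2.Cfg.mk _ _) (update_toStacks_some o S ⟨k, h⟩ _)⟩
  | drop k S =>
    exact fun h _ _ hm => .of_stepAux fun v => ⟨v, by
      rw [hm]; exact congrArg (TM2.Cfg.mk _ _) (update_toStacks_some o S ⟨k, h⟩ _)⟩
  | move j k S => exact fun h _ _ hm => reaches_move m o h (hm ()) S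
  | @seq p q _ _ _ _ _ _ _ ihp ihq =>
    intro h emb exit hm
    exact (ihp (max_le_iff.1 h).1 (emb ∘ Sum.inl) _ fun l => hm (Sum.inl l)).trans
      (ihq (max_le_iff.1 h).2 (emb ∘ Sum.inr) _ fun l => hm (Sum.inr l))
  | @if_pos k a p q S S' T hk _ ih =>
    intro h emb exit hm
    have htest := reaches_ifHead m o h (hm none) S
    rw [_root_.if_pos hk] at htest
    exact (htest.trans (ih (max_le_iff.1 (max_le_iff.1 h).2).1 (emb ∘ some ∘ Sum.inl) exit
      fun l => hm (some (Sum.inl l)))).mono (Nat.add_comm 1 T).le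
  | @if_neg k a p q S S' T hk _ ih =>
    intro h emb exit hm
    have htest := reaches_ifHead m o h (hm none) S
    rw [_root_.if_neg hk] at htest
    exact (htest.trans (ih (max_le_iff.1 (max_le_iff.1 h).2).2 (emb ∘ some ∘ Sum.inr) exit
      fun l => hm (some (Sum.inr l)))).mono (Nat.add_comm 1 T).le
  | @loop_nil k p S hk =>
    intro h emb exit hm
    have htest := reaches_loop m o h (hm none) S
    rwa [_root_.if_neg (by simp [hk])] at htest
  | @loop_cons k p S S' S'' T T' hk _ _ ihp ihloop =>
    intro h emb exit hm
    have htest := reaches_loop m o h (hm none) S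
    rw [_root_.if_pos (by simpa using hk)] at htest
    exact ((htest.trans (ihp (max_le_iff.1 h).2 (emb ∘ some) (emb none) fun l => hm (some l))).trans
      (ihloop h emb exit hm)).mono (by omega)
  | mono _ hT ih => exact fun h emb exit hm => (ih h emb exit hm).mono hT

variable [Fintype Γ]

/-- The Turing machine that runs `p` on the input stack `0` and then answers whether the stack `r`
is nonempty. -/
def machine (p : Prog Γ) (r : ℕ) : FinTM2 where
  K := Option (Fin (max p.numStacks (r + 1)))
  k₀ := some ⟨0, lt_max_of_lt_right r.succ_pos⟩
  k₁ := none
  Γ := StackAlphabet Γ _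
  Λ := Option (Label p)
  main := some (entry p)
  σ := Option Γ
  initialState := none
  Γk₀Fin := inferInstanceAs (Fintype Γ)
  m := fun l => l.elim (answer ⟨r, lt_max_of_lt_right r.lt_succ_self⟩)
    (code p (le_max_left ..) some none)

theorem initList_machine (p : Prog Γ) (r : ℕ) (w : List Γ) : initList (machine p r) w =
    ⟨some (some (entry p)), none, toStacks (max p.numStacks (r + 1)) [] (Store.single 0 w)⟩ := by
  refine congrArg (TM2.Cfg.mk (some (some (entry p))) none) ?_
  funext k
  rcases k with _ | k
  · rfl
  · obtain rfl | hk := eq_or_ne k ⟨0, by omega⟩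
    · rfl
    · exact (dif_neg ((Option.some_injective _).ne hk)).trans
        (Store.single_of_ne (Fin.val_injective.ne hk) w).symm

theorem haltList_machine (p : Prog Γ) (r : ℕ) (o : List Bool) : haltList (machine p r) o =
    ⟨none, none, toStacks (max p.numStacks (r + 1)) o fun _ => []⟩ := by
  refine congrArg (TM2.Cfg.mk none none) ?_
  funext k
  rcases k with _ | k <;> rfl

theorem Runs.outputsInTime {p : Prog Γ} {r T : ℕ} {w l : List Γ}
    (h : Runs p (Store.single 0 w) (Store.single r l) T) (hl : l.tail = []) :
    Nonempty (TM2OutputsInTime (machine p r) w (some [l.head?.isSome]) (T + 1)) := by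
  obtain ⟨v, ⟨hrun⟩⟩ := h.reaches (machine p r).m [] (le_max_left ..) some none (fun _ => rfl) none
  have hlast : (machine p r).step ⟨some none, v, toStacks _ [] (Store.single r l)⟩ =
      some (haltList (machine p r) [l.head?.isSome]) := by
    refine congrArg some ((stepAux_answer (Λ := Option (Label p)) _ v _).trans ?_)
    simp only [Store.single_self, Store.update_single, hl, Store.single_nil]
    exact (haltList_machine p r _).symm
  have hfirst : StateTransition.EvalsToInTime (machine p r).step (initList (machine p r) w)
      (some ⟨some none, v, toStacks _ [] (Store.single r l)⟩) T :=
    (initList_machine p r w).symm ▸ hrun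
  exact ⟨Nat.add_comm 1 T ▸ hfirst.trans _ _ _ _ _ _ ⟨⟨1, hlast⟩, le_rfl⟩⟩

omit [DecidableEq Γ] [Fintype Γ] in
theorem inP_of_runs [Finite Γ] {L : Language Γ} (p : Prog Γ) (r : ℕ) (a : Γ) (time : Polynomial ℕ)
    (haccept : ∀ w ∈ L, Runs p (Store.single 0 w) (Store.single r [a]) (time.eval w.length))
    (hreject : ∀ w ∉ L, Runs p (Store.single 0 w) (Store.single r []) (time.eval w.length)) :
    InP L := by
  classical
  have := Fintype.ofFinite Γ
  refine ⟨{ tm := machine p r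
            inputAlphabet := Equiv.refl Γ
            outputAlphabet := Equiv.refl Bool
            time := time + 1
            outputsFun := fun w => Classical.choice ?_ }⟩
  have houtput : Nonempty (TM2OutputsInTime (machine p r) w (some [decide (w ∈ L)])
      (time.eval w.length + 1)) := by
    by_cases hw : w ∈ L
    · simpa only [hw, decide_true] using! (haccept w hw).outputsInTime rfl
    · simpa only [hw, decide_false] using! (hreject w hw).outputsInTime rfl
  rw [Polynomial.eval_add, Polynomial.eval_one]
  exact (List.map_id w).symm ▸ houtput

end Prog

end Compilation

section StackArithmetic

variable {Γ : Type}

namespace Prog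

open Function

theorem Runs.congr {p : Prog Γ} {S S' S'' : Store Γ} {T : ℕ} (h : Runs p S S' T)
    (hS : ∀ k, S' k = S'' k) : Runs p S S'' T :=
  (funext hS : S' = S'') ▸ h

theorem runs_moveAll {j k : ℕ} (hjk : j ≠ k) (l : List Γ) : ∀ S : Store Γ, S j = l →
    Runs (loop j (move j k)) S (update (update S j []) k (l.reverse ++ S k))
      (2 * l.length + 1) := by
  induction l with
  | nil =>
    intro S hl
    refine (Runs.loop_nil hl).congr fun i => ?_
    simp only [update_apply]
    split_ifs <;> simp_all
  | cons a l ih =>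
    intro S hl
    refine ((Runs.loop_cons (by simp [hl]) (.move j k S) (ih _ (by simp [hjk, hl]))).congr
      fun i => ?_).mono (by simp only [List.length_cons]; omega)
    simp only [update_apply]
    split_ifs <;> simp_all

theorem runs_dropAll (k : ℕ) (l : List Γ) : ∀ S : Store Γ, S k = l →
    Runs (loop k (drop k)) S (update S k []) (2 * l.length + 1) := by
  induction l with
  | nil =>
    intro S hl
    exact (Runs.loop_nil hl).congr fun i => by rw [← hl, update_eq_self]
  | cons a l ih =>
    intro S hl
    refine ((Runs.loop_cons (by simp [hl]) (.drop k S) (ih _ (by simp [hl]))).congr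
      fun i => by rw [update_idem]).mono (by simp only [List.length_cons]; omega)

variable [Inhabited Γ]

/-- The representation of a number on a stack, in unary. -/
abbrev unary (n : ℕ) : List Γ := List.replicate n default

theorem unary_append_cons_default (n : ℕ) (l : List Γ) :
    unary n ++ default :: l = unary (n + 1) ++ l := by
  rw [unary, unary, List.replicate_succ', List.append_assoc, List.singleton_append]

theorem runs_countAll {j k r : ℕ} (hjk : j ≠ k) (hjr : j ≠ r) (hkr : k ≠ r) (l : List Γ) :
    ∀ S : Store Γ, S j = l →
    Runs (loop j (seq (push r default) (move j k))) S
      (update (update (update S j []) k (l.reverse ++ S k)) r (unary l.length ++ S r))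
      (3 * l.length + 1) := by
  induction l with
  | nil =>
    intro S hl
    refine (Runs.loop_nil hl).congr fun i => ?_
    simp only [update_apply]
    split_ifs <;> simp_all
  | cons a l ih =>
    intro S hl
    refine ((Runs.loop_cons (by simp [hl]) ((Runs.push r default S).seq (.move j k _))
      (ih _ (by simp [hl, hjk, hjr]))).congr fun i => ?_).mono
      (by simp only [List.length_cons]; omega)
    simp only [update_apply, List.length_cons]
    split_ifs <;> simp_all [unary_append_cons_default]

theorem runs_seek {j k r : ℕ} (hjk : j ≠ k) (hjr : j ≠ r) (hkr : k ≠ r) (n : ℕ) :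
    ∀ S : Store Γ, S r = unary n →
    Runs (loop r (seq (drop r) (move j k))) S
      (update (update (update S j ((S j).drop n)) k (((S j).take n).reverse ++ S k)) r [])
      (3 * n + 1) := by
  induction n with
  | zero =>
    intro S hn
    refine (Runs.loop_nil hn).congr fun i => ?_
    simp only [update_apply]
    split_ifs <;> simp_all
  | succ n ih =>
    intro S hn
    refine ((Runs.loop_cons (by simp [hn, List.replicate_succ])
      ((Runs.drop r S).seq (.move j k _))
      (ih _ (by simp [hn, hjr.symm, hkr.symm]))).congr fun i => ?_).mono (by omega)
    rcases hl : S j with _ | ⟨a, l⟩ <;> simp only [update_apply] <;> split_ifs <;> simp_all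

theorem runs_subtract {j r : ℕ} (hjr : j ≠ r) (n : ℕ) :
    ∀ (S : Store Γ) (m : ℕ), S r = unary n → S j = unary m →
    Runs (loop r (seq (drop r) (drop j))) S (update (update S j (unary (m - n))) r [])
      (3 * n + 1) := by
  induction n with
  | zero =>
    intro S m hn hm
    refine (Runs.loop_nil hn).congr fun i => ?_
    simp only [update_apply]
    split_ifs <;> simp_all
  | succ n ih =>
    intro S m hn hm
    refine ((Runs.loop_cons (by simp [hn, List.replicate_succ]) ((Runs.drop r S).seq (.drop j _))
      (ih _ (m - 1) (by simp [hn, hjr.symm]) (by simp [hm, hjr]))).congr fun i => ?_).mono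
      (by omega)
    simp only [update_apply, show m - 1 - n = m - (n + 1) by omega]
    split_ifs <;> simp_all

/-- One round of the loop evaluating a bounded sum: if `p` writes the next summand on the stack
`r + 3`, the round adds it to the stack `r`, decrements the number of remaining summands on the
stack `r + 1`, and increments the summation index on the stack `r + 2`. -/
def addSummand (r : ℕ) (p : Prog Γ) : Prog Γ :=
  seq (drop (r + 1)) (seq p (seq (loop (r + 3) (move (r + 3) r)) (push (r + 2) default)))

/-- The store during the evaluation of a bounded sum: `S`, except that the stacks `r`, `r + 1` and
`r + 2` hold the current sum, the number of remaining summands and the summation index. -/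
def sumStore (S : Store Γ) (r sum rest i : ℕ) : Store Γ :=
  update (update (update S r (unary sum)) (r + 1) (unary rest)) (r + 2) (unary i)

theorem runs_addSummand {p : Prog Γ} {r sum rest i x T : ℕ} {S : Store Γ} (hS : S (r + 3) = [])
    (hp : Runs p (sumStore S r sum rest i)
      (update (sumStore S r sum rest i) (r + 3) (unary x)) T) :
    Runs (addSummand r p) (sumStore S r sum (rest + 1) i) (sumStore S r (sum + x) rest (i + 1))
      (T + 2 * x + 3) := by
  have hdrop : Runs (drop (r + 1)) (sumStore S r sum (rest + 1) i) (sumStore S r sum rest i) 1 :=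
    (Runs.drop (r + 1) _).congr fun k => by
      simp only [sumStore, update_apply]
      split_ifs <;> first | omega | simp_all [List.replicate_succ]
  have hadd := runs_moveAll (show r + 3 ≠ r by omega) (unary x) _
    (update_self (r + 3) (unary x) (sumStore S r sum rest i))
  refine ((hdrop.seq (hp.seq (hadd.seq (.push (r + 2) default _)))).congr fun k => ?_).mono
    (by simp only [List.length_replicate]; omega)
  simp only [sumStore, update_apply]
  split_ifs <;> first | omega | simp_all [Nat.add_comm, List.replicate_succ]

theorem runs_loop_addSummand {p : Prog Γ} {r : ℕ} {S : Store Γ} {f g : ℕ → ℕ}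
    (hS : S (r + 3) = [])
    (hp : ∀ sum rest i, Runs p (sumStore S r sum rest i)
      (update (sumStore S r sum rest i) (r + 3) (unary (f i))) (g i))
    (c : ℕ) : ∀ i sum : ℕ,
      Runs (loop (r + 1) (addSummand r p)) (sumStore S r sum c i)
        (sumStore S r (sum + ∑ j ∈ Finset.range c, f (i + j)) 0 (i + c))
        (∑ j ∈ Finset.range c, (g (i + j) + 2 * f (i + j) + 4) + 1) := by
  induction c with
  | zero => exact fun i sum => .loop_nil (by simp [sumStore])
  | succ c ih =>
    intro i sum
    have hround := Runs.loop_cons (by simp [sumStore, List.replicate_succ])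
      (runs_addSummand hS (hp sum c i)) (ih (i + 1) (sum + f i))
    have hshift (j : ℕ) : i + 1 + j = i + (j + 1) := by omega
    simp only [hshift, add_assoc sum, add_comm (f i)] at hround
    simp only [Finset.sum_range_succ', Nat.add_zero]
    exact hround.mono (by omega)

end Prog

end StackArithmetic

/-! ### Arithmetic expressions and definability -/

/-- Arithmetic expressions over a word and a list of numbers, with bounded sums. In `sum b e`, the
variable `0` of `e` is the summation index, and the variables of the context are shifted by one. -/
inductive Expr (Γ : Type) : Type
  | len : Expr Γ
  | one : Expr Γ
  | var (i : ℕ) : Expr Γ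
  | sym (a : Γ) (e : Expr Γ) : Expr Γ
  | add (e f : Expr Γ) : Expr Γ
  | sub (e f : Expr Γ) : Expr Γ
  | sum (b e : Expr Γ) : Expr Γ

namespace Expr

open Prog Function

variable {Γ : Type}

/-- The value of an expression over the word `w`; `sym a e` is `1` if the symbol at position `e` is
`a`, and `0` otherwise. -/
def eval [DecidableEq Γ] (w : List Γ) : Expr Γ → List ℕ → ℕ
  | len, _ => w.length
  | one, _ => 1
  | var i, v => v.getD i 0
  | sym a e, v => if w[e.eval w v]? = some a then 1 else 0
  | add e f, v => e.eval w v + f.eval w v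
  | sub e f, v => e.eval w v - f.eval w v
  | sum b e, v => ∑ i ∈ Finset.range (b.eval w v), e.eval w (i :: v)

/-- A program writing the value of an expression on the stack `r`. The input is on the stack `0`,
the variables are on the stacks `ρ`, and the stack `1` and those from `r` on are used as work
space. -/
def compile [Inhabited Γ] : Expr Γ → List ℕ → ℕ → Prog Γ
  | len, _, r => .seq (.loop 0 (.seq (.push r default) (.move 0 1))) (.loop 1 (.move 1 0))
  | one, _, r => .push r default
  | var i, ρ, r => (ρ[i]?).elim .skip fun k =>
      .seq (.loop k (.seq (.push r default) (.move k (r + 1)))) (.loop (r + 1) (.move (r + 1) k))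
  | sym a e, ρ, r => .seq (e.compile ρ (r + 1))
      (.seq (.loop (r + 1) (.seq (.drop (r + 1)) (.move 0 1)))
        (.seq (.ifHead 0 a (.push r default) .skip) (.loop 1 (.move 1 0))))
  | add e f, ρ, r => .seq (e.compile ρ r)
      (.seq (f.compile ρ (r + 1)) (.loop (r + 1) (.move (r + 1) r)))
  | sub e f, ρ, r => .seq (e.compile ρ r)
      (.seq (f.compile ρ (r + 1)) (.loop (r + 1) (.seq (.drop (r + 1)) (.drop r))))
  | sum b e, ρ, r => .seq (b.compile ρ (r + 1))
      (.seq (.loop (r + 1) (addSummand r (e.compile ((r + 2) :: ρ) (r + 3))))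
        (.loop (r + 2) (.drop (r + 2))))

/-- A bound on the running time of a compiled expression. -/
def cost [DecidableEq Γ] (w : List Γ) : Expr Γ → List ℕ → ℕ
  | len, _ => 5 * w.length + 2
  | one, _ => 1
  | var i, v => 5 * v.getD i 0 + 2
  | sym _ e, v => e.cost w v + 3 * e.eval w v + 2 * w.length + 4
  | add e f, v => e.cost w v + f.cost w v + 2 * f.eval w v + 1
  | sub e f, v => e.cost w v + f.cost w v + 3 * f.eval w v + 1
  | sum b e, v => b.cost w v + ∑ i ∈ Finset.range (b.eval w v),
      (e.cost w (i :: v) + 2 * e.eval w (i :: v) + 4) + 2 * b.eval w v + 2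

variable [Inhabited Γ]

/-- The stores in which an expression compiled for the variable stacks `ρ` and the result stack `r`
can be run, with input `w` and variables `v`. -/
structure Ready (w : List Γ) (ρ v : List ℕ) (r : ℕ) (S : Store Γ) : Prop where
  two_le : 2 ≤ r
  input : S 0 = w
  aux : S 1 = []
  env : List.Forall₂ (fun k x => (2 ≤ k ∧ k < r) ∧ S k = unary x) ρ v
  free : ∀ k, r ≤ k → S k = []

theorem Ready.of_eq {w : List Γ} {ρ v : List ℕ} {r r' : ℕ} {S S' : Store Γ}
    (h : Ready w ρ v r S) (hr : r ≤ r') (hS : ∀ k < r, S' k = S k)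
    (hfree : ∀ k, r' ≤ k → S' k = []) : Ready w ρ v r' S' where
  two_le := h.two_le.trans hr
  input := (hS 0 (by have := h.two_le; omega)).trans h.input
  aux := (hS 1 (by have := h.two_le; omega)).trans h.aux
  env := h.env.imp fun k x hk => ⟨⟨hk.1.1, hk.1.2.trans_le hr⟩, (hS k hk.1.2).trans hk.2⟩
  free := hfree

theorem Ready.succ {w : List Γ} {ρ v : List ℕ} {r : ℕ} {S : Store Γ} (h : Ready w ρ v r S) :
    Ready w ρ v (r + 1) S :=
  h.of_eq (by omega) (fun _ _ => rfl) fun k hk => h.free k (by omega)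

theorem Ready.update_succ {w : List Γ} {ρ v : List ℕ} {r : ℕ} {S : Store Γ}
    (h : Ready w ρ v r S) (l : List Γ) : Ready w ρ v (r + 1) (update S r l) :=
  h.of_eq (by omega) (fun _ hk => update_of_ne hk.ne ..) fun k hk => by
    rw [update_of_ne (by omega), h.free k (by omega)]

variable [DecidableEq Γ]

/-- The correctness of `compile` for the expression `e` on the input `w`. -/
def CompilesOn (w : List Γ) (e : Expr Γ) : Prop :=
  ∀ (ρ v : List ℕ) (r : ℕ) (S : Store Γ), Ready w ρ v r S →
    Runs (e.compile ρ r) S (update S r (unary (e.eval w v))) (e.cost w v)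

variable {w : List Γ} {e f : Expr Γ}

theorem compilesOn_len : CompilesOn w len := by
  intro ρ v r S h
  have := h.two_le
  have hr := h.free r le_rfl
  have hin := h.input
  have haux := h.aux
  have hcount := runs_countAll zero_ne_one (show 0 ≠ r by omega) (show 1 ≠ r by omega) w S hin
  have hback := runs_moveAll one_ne_zero w.reverse _
    (show update (update (update S 0 []) 1 (w.reverse ++ S 1)) r (unary w.length ++ S r) 1 = _ by
      simp [haux, show 1 ≠ r by omega])
  refine ((hcount.seq hback).congr fun k => ?_).mono
    (by simp only [List.length_reverse, cost]; omega)
  simp only [update_apply, eval]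
  split_ifs <;> simp_all

theorem compilesOn_one : CompilesOn w one := fun _ _ r S h =>
  (Runs.push r default S).congr fun i => by simp [h.free r le_rfl, eval]

theorem compilesOn_var (i : ℕ) : CompilesOn w (var i) := by
  intro ρ v r S h
  have := h.two_le
  have hr := h.free r le_rfl
  have hr1 := h.free (r + 1) (by omega)
  have hlen := h.env.length_eq
  rcases lt_or_ge i ρ.length with hi | hi
  · have hk := h.env.get hi (hlen ▸ hi)
    have hv : v.getD i 0 = v[i]'(hlen ▸ hi) := by simp [List.getD, hlen ▸ hi]
    simp only [List.get_eq_getElem] at hk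
    simp only [compile, List.getElem?_eq_getElem hi, Option.elim_some, eval, cost, hv]
    generalize ρ[i] = k at hk
    generalize v[i]'(hlen ▸ hi) = x at hk
    have hcount := runs_countAll (show k ≠ r + 1 by omega) (show k ≠ r by omega)
      (show r + 1 ≠ r by omega) _ S hk.2
    refine ((hcount.seq (runs_moveAll (by omega) (unary x) _ (by simp [hr1]))).congr
      fun i => ?_).mono (by simp only [List.length_replicate]; omega)
    simp only [update_apply]
    split_ifs <;> first | omega | simp_all
  · have hv : v.getD i 0 = 0 := by simp [List.getD, hlen ▸ hi]
    simp only [compile, List.getElem?_eq_none hi, Option.elim_none, eval, cost, hv]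
    refine ((Runs.skip S).congr fun i => ?_).mono (by omega)
    simp only [update_apply]
    split_ifs <;> simp_all

theorem runs_ifHead_push (S : Store Γ) (k r : ℕ) (a : Γ) :
    Runs (.ifHead k a (.push r default) .skip) S
      (update S r (unary (if (S k).head? = some a then 1 else 0) ++ S r)) 2 := by
  split_ifs with ha
  · exact .if_pos ha (.push r default S)
  · exact .if_neg ha ((Runs.skip S).congr fun i => by simp)

theorem CompilesOn.sym (a : Γ) (he : CompilesOn w e) : CompilesOn w (.sym a e) := by
  intro ρ v r S h
  have := h.two_le
  have hr0 : 0 ≠ r := by omega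
  have hr1 : 1 ≠ r := by omega
  have hin := h.input
  have haux := h.aux
  have hres := h.free r le_rfl
  have hidx := h.free (r + 1) (by omega)
  set x := e.eval w v
  set S₁ := update (update S 0 (w.drop x)) 1 (w.take x).reverse
  have hseek : Runs (.loop (r + 1) (.seq (.drop (r + 1)) (.move 0 1)))
      (update S (r + 1) (unary x)) S₁ (3 * x + 1) :=
    (runs_seek zero_ne_one (by omega) (by omega) _ _ (update_self ..)).congr fun k => by
      simp only [S₁, update_apply]
      split_ifs <;> first | omega | simp_all
  have hpush : Runs (.ifHead 0 a (.push r default) .skip) S₁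
      (update S₁ r (unary (eval w (.sym a e) v))) 2 :=
    (runs_ifHead_push S₁ 0 r a).congr fun k => by
      simp [S₁, eval, x, hr0.symm, hr1.symm, hres, List.head?_drop]
  have hback := runs_moveAll one_ne_zero (w.take x).reverse
    (update S₁ r (unary (eval w (.sym a e) v))) (by simp [S₁, hr1])
  refine (((he ρ v (r + 1) S h.succ).seq (hseek.seq (hpush.seq hback))).congr fun k => ?_).mono ?_
  · simp only [S₁, update_apply]
    split_ifs <;> first | omega | simp_all
  · have := min_le_right x w.length
    simp only [cost, List.length_reverse, List.length_take]
    omega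

theorem CompilesOn.add (he : CompilesOn w e) (hf : CompilesOn w f) :
    CompilesOn w (add e f) := by
  intro ρ v r S h
  have := h.free r le_rfl
  have hr1 := h.free (r + 1) (by omega)
  have hadd := runs_moveAll (show r + 1 ≠ r by omega) (unary (f.eval w v)) _
    (update_self (r + 1) _ (update S r (unary (e.eval w v))))
  refine (((he ρ v r S h).seq ((hf ρ v (r + 1) _ (h.update_succ _)).seq hadd)).congr
    fun k => ?_).mono (by simp only [cost, List.length_replicate]; omega)
  simp only [update_apply, eval]
  split_ifs <;> first | omega | simp_all [Nat.add_comm]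

theorem CompilesOn.sub (he : CompilesOn w e) (hf : CompilesOn w f) :
    CompilesOn w (sub e f) := by
  intro ρ v r S h
  have := h.free r le_rfl
  have hr1 := h.free (r + 1) (by omega)
  have hsub := runs_subtract (show r ≠ r + 1 by omega) (f.eval w v)
    (update (update S r (unary (e.eval w v))) (r + 1) (unary (f.eval w v))) (e.eval w v)
    (by simp) (by simp)
  refine (((he ρ v r S h).seq ((hf ρ v (r + 1) _ (h.update_succ _)).seq hsub)).congr
    fun k => ?_).mono (by simp only [cost]; omega)
  simp only [update_apply, eval]
  split_ifs <;> first | omega | simp_all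

theorem CompilesOn.sum (he : CompilesOn w e) (hf : CompilesOn w f) :
    CompilesOn w (sum e f) := by
  intro ρ v r S h
  have hr := h.free r le_rfl
  have hr1 := h.free (r + 1) (by omega)
  have hr2 := h.free (r + 2) (by omega)
  have hbody (s c i : ℕ) : Runs (f.compile ((r + 2) :: ρ) (r + 3)) (sumStore S r s c i)
      (update (sumStore S r s c i) (r + 3) (unary (f.eval w (i :: v)))) (f.cost w (i :: v)) := by
    have hready : Ready w ρ v (r + 3) (sumStore S r s c i) := h.of_eq (by omega)
      (fun k hk => by simp [sumStore, hk.ne, show k ≠ r + 1 by omega, show k ≠ r + 2 by omega])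
      (fun k hk => by
        simp [sumStore, show k ≠ r by omega, show k ≠ r + 1 by omega, show k ≠ r + 2 by omega,
          h.free k (by omega)])
    have := h.two_le
    exact hf _ _ _ _
      { hready with env := .cons ⟨⟨by omega, by omega⟩, by simp [sumStore]⟩ hready.env }
  have hstart : update S (r + 1) (unary (e.eval w v)) = sumStore S r 0 (e.eval w v) 0 := by
    funext k
    simp only [sumStore, update_apply]
    split_ifs <;> simp_all
  have hloop := runs_loop_addSummand (h.free (r + 3) (by omega)) hbody (e.eval w v) 0 0
  have hclear := runs_dropAll (r + 2) (unary (e.eval w v)) (sumStore S r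
    (0 + ∑ i ∈ Finset.range (e.eval w v), f.eval w ((0 + i) :: v)) 0 (0 + e.eval w v))
    (by simp [sumStore])
  refine (((he ρ v (r + 1) S h.succ).seq ((hstart ▸ hloop).seq hclear)).congr fun k => ?_).mono
    (by simp only [cost, List.length_replicate, Nat.zero_add]; omega)
  simp only [sumStore, update_apply, eval, Nat.zero_add]
  split_ifs <;> first | omega | simp_all

theorem compilesOn (w : List Γ) (e : Expr Γ) : CompilesOn w e := by
  induction e with
  | len => exact compilesOn_len
  | one => exact compilesOn_one
  | var i => exact compilesOn_var i
  | sym a _ he => exact he.sym a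
  | add _ _ he hf => exact he.add hf
  | sub _ _ he hf => exact he.sub hf
  | sum _ _ he hf => exact he.sum hf

end Expr

namespace Expr

open Prog Function

variable {Γ : Type}

/-- Functions of a word and a list of numbers that are bounded by a fixed power of every number
`X ≥ 2` bounding the length of the word and the numbers in the list. -/
def PolyBounded (f : List Γ → List ℕ → ℕ) : Prop :=
  ∃ c : ℕ, ∀ (w : List Γ) (v : List ℕ) (X : ℕ), 2 ≤ X → w.length ≤ X → (∀ x ∈ v, x ≤ X) →
    f w v ≤ X ^ c

namespace PolyBounded

variable {f g : List Γ → List ℕ → ℕ}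

theorem const (c : ℕ) : PolyBounded fun (_ : List Γ) _ => c :=
  ⟨c, fun _ _ _ hX _ _ => Nat.lt_two_pow_self.le.trans (Nat.pow_le_pow_left hX c)⟩

theorem length : PolyBounded fun (w : List Γ) _ => w.length :=
  ⟨1, fun _ _ X _ hw _ => by simpa only [pow_one] using hw⟩

theorem var (i : ℕ) : PolyBounded fun (_ : List Γ) v => v.getD i 0 :=
  ⟨1, fun _ v _ _ _ hv => by
    rcases lt_or_ge i v.length with hi | hi
    · simpa [List.getD, hi] using hv _ (List.getElem_mem hi)
    · simp [List.getD, hi]⟩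

theorem mono (hf : PolyBounded f) (h : ∀ w v, g w v ≤ f w v) : PolyBounded g :=
  let ⟨a, ha⟩ := hf
  ⟨a, fun w v X hX hw hv => (h w v).trans (ha w v X hX hw hv)⟩

theorem mul (hf : PolyBounded f) (hg : PolyBounded g) :
    PolyBounded fun w v => f w v * g w v := by
  obtain ⟨a, ha⟩ := hf
  obtain ⟨b, hb⟩ := hg
  refine ⟨a + b, fun w v X hX hw hv => ?_⟩
  rw [pow_add]
  exact Nat.mul_le_mul (ha w v X hX hw hv) (hb w v X hX hw hv)

theorem add (hf : PolyBounded f) (hg : PolyBounded g) :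
    PolyBounded fun w v => f w v + g w v := by
  obtain ⟨a, ha⟩ := hf
  obtain ⟨b, hb⟩ := hg
  refine ⟨max a b + 1, fun w v X hX hw hv => ?_⟩
  calc f w v + g w v ≤ X ^ max a b + X ^ max a b := Nat.add_le_add
        ((ha w v X hX hw hv).trans (Nat.pow_le_pow_right (by omega) (le_max_left a b)))
        ((hb w v X hX hw hv).trans (Nat.pow_le_pow_right (by omega) (le_max_right a b)))
    _ = X ^ max a b * 2 := (mul_two _).symm
    _ ≤ X ^ (max a b + 1) := Nat.mul_le_mul_left _ hX

theorem sum (hf : PolyBounded f) (hg : PolyBounded g) :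
    PolyBounded fun w v => ∑ i ∈ Finset.range (f w v), g w (i :: v) := by
  obtain ⟨a, ha⟩ := hf
  obtain ⟨c, hc⟩ := hg
  refine ⟨a + (a + 1) * c, fun w v X hX hw hv => ?_⟩
  have hX' : X ≤ X ^ (a + 1) := Nat.le_self_pow (by omega) X
  have hrange := ha w v X hX hw hv
  have hindex {i : ℕ} (hi : i ∈ Finset.range (f w v)) : i ≤ X ^ (a + 1) :=
    ((Finset.mem_range.1 hi).le.trans hrange).trans (Nat.pow_le_pow_right (by omega) (by omega))
  have hterm : ∀ i ∈ Finset.range (f w v), g w (i :: v) ≤ (X ^ (a + 1)) ^ c := fun i hi =>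
    hc w _ _ (hX.trans hX') (hw.trans hX')
      (List.forall_mem_cons.2 ⟨hindex hi, fun x hx => (hv x hx).trans hX'⟩)
  calc ∑ i ∈ Finset.range (f w v), g w (i :: v)
      ≤ ∑ _i ∈ Finset.range (f w v), (X ^ (a + 1)) ^ c := Finset.sum_le_sum hterm
    _ = f w v * (X ^ (a + 1)) ^ c := by rw [Finset.sum_const, Finset.card_range, smul_eq_mul]
    _ ≤ X ^ a * (X ^ (a + 1)) ^ c := Nat.mul_le_mul_right _ hrange
    _ = X ^ (a + (a + 1) * c) := by rw [pow_add X a ((a + 1) * c), pow_mul]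

end PolyBounded

variable [DecidableEq Γ]

theorem polyBounded_eval (e : Expr Γ) : PolyBounded fun w v => e.eval w v := by
  induction e with
  | len => exact .length
  | one => exact .const 1
  | var i => exact .var i
  | sym a e _ =>
    refine (PolyBounded.const 1).mono fun w v => ?_
    simp only [eval]
    split_ifs <;> omega
  | add e f he hf => exact he.add hf
  | sub e f he _ => exact he.mono fun w v => Nat.sub_le _ _
  | sum b e hb he => exact hb.sum he

theorem polyBounded_cost (e : Expr Γ) : PolyBounded fun w v => e.cost w v := by
  induction e with
  | len => exact ((PolyBounded.const 5).mul .length).add (.const 2)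
  | one => exact .const 1
  | var i => exact ((PolyBounded.const 5).mul (.var i)).add (.const 2)
  | sym _ e he =>
    exact ((he.add ((PolyBounded.const 3).mul e.polyBounded_eval)).add
      ((PolyBounded.const 2).mul .length)).add (.const 4)
  | add e f he hf =>
    exact ((he.add hf).add ((PolyBounded.const 2).mul f.polyBounded_eval)).add (.const 1)
  | sub e f he hf =>
    exact ((he.add hf).add ((PolyBounded.const 3).mul f.polyBounded_eval)).add (.const 1)
  | sum b e hb he =>
    exact ((hb.add (b.polyBounded_eval.sum
      ((he.add ((PolyBounded.const 2).mul e.polyBounded_eval)).add (.const 4)))).add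
        ((PolyBounded.const 2).mul b.polyBounded_eval)).add (.const 2)

theorem inP [Inhabited Γ] [Finite Γ] {L : Language Γ} (e : Expr Γ)
    (hone : ∀ w ∈ L, e.eval w [] = 1) (hzero : ∀ w ∉ L, e.eval w [] = 0) : InP L := by
  obtain ⟨c, hc⟩ := e.polyBounded_cost
  set p : Prog Γ := .seq (e.compile [] 2) (.loop 0 (.drop 0))
  set time : Polynomial ℕ := (Polynomial.X + 2) ^ c + 2 * Polynomial.X + 1 with htime
  have hrun {w : List Γ} {n : ℕ} (hn : e.eval w [] = n) :
      Runs p (Store.single 0 w) (Store.single 2 (unary n)) (time.eval w.length) := by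
    have hready : Ready w [] [] 2 (Store.single 0 w) :=
      { two_le := le_rfl
        input := Store.single_self 0 w
        aux := Store.single_of_ne (by omega) w
        env := .nil
        free := fun k hk => Store.single_of_ne (by omega) w }
    have hcost : e.cost w [] ≤ (w.length + 2) ^ c :=
      hc w [] (w.length + 2) (by omega) (by omega) (by simp)
    refine (((e.compilesOn w [] [] 2 _ hready).seq
      (runs_dropAll 0 w _ (by simp))).congr fun k => ?_).mono ?_
    · simp only [Store.single, update_apply]
      split_ifs <;> simp_all
    · simp only [htime, Polynomial.eval_add, Polynomial.eval_pow, Polynomial.eval_X,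
        Polynomial.eval_mul, Polynomial.eval_ofNat, Polynomial.eval_one]
      omega
  exact p.inP_of_runs 2 default time (fun w hw => hrun (hone w hw)) fun w hw => hrun (hzero w hw)

/-- Renaming of variables. -/
def rename (g : ℕ → ℕ) : Expr Γ → Expr Γ
  | len => len
  | one => one
  | var i => var (g i)
  | sym a e => sym a (e.rename g)
  | add e f => add (e.rename g) (f.rename g)
  | sub e f => sub (e.rename g) (f.rename g)
  | sum b e => sum (b.rename g) (e.rename fun i => Nat.casesOn i 0 fun i => g i + 1)

theorem eval_rename (w : List Γ) (e : Expr Γ) : ∀ (g : ℕ → ℕ) (v v' : List ℕ),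
    (∀ i, v'.getD (g i) 0 = v.getD i 0) → (e.rename g).eval w v' = e.eval w v := by
  induction e with
  | len => intros; rfl
  | one => intros; rfl
  | var i => intro g v v' h; exact h i
  | sym a e he => intro g v v' h; simp only [rename, eval, he g v v' h]
  | add e f he hf => intro g v v' h; simp only [rename, eval, he g v v' h, hf g v v' h]
  | sub e f he hf => intro g v v' h; simp only [rename, eval, he g v v' h, hf g v v' h]
  | sum b e hb he =>
    intro g v v' h
    simp only [rename, eval, hb g v v' h]
    refine Finset.sum_congr rfl fun x _ => he _ _ _ fun i => ?_
    cases i with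
    | zero => simp
    | succ i => simpa using h i

/-- Simultaneous substitution of expressions for variables. -/
def subst (s : ℕ → Expr Γ) : Expr Γ → Expr Γ
  | len => len
  | one => one
  | var i => s i
  | sym a e => sym a (e.subst s)
  | add e f => add (e.subst s) (f.subst s)
  | sub e f => sub (e.subst s) (f.subst s)
  | sum b e => sum (b.subst s)
      (e.subst fun i => Nat.casesOn i (var 0) fun i => (s i).rename Nat.succ)

theorem eval_subst (w : List Γ) (e : Expr Γ) : ∀ (s : ℕ → Expr Γ) (v v' : List ℕ),
    (∀ i, (s i).eval w v' = v.getD i 0) → (e.subst s).eval w v' = e.eval w v := by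
  induction e with
  | len => intros; rfl
  | one => intros; rfl
  | var i => intro s v v' h; exact h i
  | sym a e he => intro s v v' h; simp only [subst, eval, he s v v' h]
  | add e f he hf => intro s v v' h; simp only [subst, eval, he s v v' h, hf s v v' h]
  | sub e f he hf => intro s v v' h; simp only [subst, eval, he s v v' h, hf s v v' h]
  | sum b e hb he =>
    intro s v v' h
    simp only [subst, eval, hb s v v' h]
    refine Finset.sum_congr rfl fun x _ => he _ _ _ fun i => ?_
    cases i with
    | zero => simp [eval]
    | succ i => simpa using ((s i).eval_rename w Nat.succ v' (x :: v') (by simp)).trans (h i)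

end Expr

/-- A context: its elements carry a word over `Γ` and finitely many natural numbers. -/
class Context (Γ : outParam Type) (X : Type) where
  word : X → List Γ
  vars : X → List ℕ

instance {Γ : Type} : Context Γ (List Γ) := ⟨id, fun _ => []⟩

instance {Γ X : Type} [Context Γ X] : Context Γ (X × ℕ) :=
  ⟨fun x => Context.word x.1, fun x => x.2 :: Context.vars x.1⟩

section Definability

open Context

variable {Γ X Y : Type} [DecidableEq Γ] [Context Γ X] [Context Γ Y]

/-- Number-valued functions given by an arithmetic expression. -/
def Definable (f : X → ℕ) : Prop :=
  ∃ e : Expr Γ, ∀ x, e.eval (word x) (vars x) = f x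

open Classical in
/-- Predicates whose indicator function is definable. -/
def DefinablePred (p : X → Prop) : Prop := Definable fun x => if p x then 1 else 0

/-- Word-valued functions such that the length and the symbols of the value are definable. -/
structure DefinableWord (s : X → List Γ) : Prop where
  length : Definable fun x => (s x).length
  symbol (a : Γ) : DefinablePred fun x : X × ℕ => (s x.1)[x.2]? = some a

/-- Maps between contexts that keep the word and whose numbers are definable. -/
structure DefinableMap (φ : X → Y) : Prop where
  word_eq (x : X) : word (φ x) = word x
  exists_vars : ∃ s : ℕ → Expr Γ, ∀ x i, (s i).eval (word x) (vars x) = (vars (φ x)).getD i 0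

theorem Definable.comp {f : Y → ℕ} (hf : Definable f) {φ : X → Y} (hφ : DefinableMap φ) :
    Definable fun x => f (φ x) := by
  obtain ⟨e, he⟩ := hf
  obtain ⟨hword, s, hs⟩ := hφ
  refine ⟨e.subst s, fun x => ?_⟩
  rw [Expr.eval_subst _ e s (vars (φ x)) _ (hs x), ← hword]
  exact he (φ x)

namespace DefinableMap

theorem fst : DefinableMap fun x : X × ℕ => x.1 :=
  ⟨fun _ => rfl, fun i => .var (i + 1), fun _ _ => by simp [Expr.eval, vars]⟩

theorem comp {Z : Type} [Context Γ Z] {φ : X → Y} {ψ : Z → X} (hφ : DefinableMap φ)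
    (hψ : DefinableMap ψ) : DefinableMap fun z => φ (ψ z) := by
  obtain ⟨hword, s, hs⟩ := hφ
  obtain ⟨hword', s', hs'⟩ := hψ
  refine ⟨fun z => (hword _).trans (hword' z), fun i => (s i).subst s', fun z i => ?_⟩
  rw [Expr.eval_subst _ (s i) s' (vars (ψ z)) _ (hs' z), ← hs, hword']

theorem pair {φ : X → Y} (hφ : DefinableMap φ) {f : X → ℕ} (hf : Definable f) :
    DefinableMap fun x => (φ x, f x) := by
  obtain ⟨hword, s, hs⟩ := hφ
  obtain ⟨e, he⟩ := hf
  refine ⟨hword, fun i => Nat.casesOn i e s, fun x i => ?_⟩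
  cases i with
  | zero => simpa [vars] using he x
  | succ i => simpa [vars] using hs x i

end DefinableMap

namespace Definable

theorem snd : Definable fun x : X × ℕ => x.2 :=
  ⟨.var 0, fun _ => by simp [Expr.eval, vars]⟩

theorem fst {f : X → ℕ} (hf : Definable f) : Definable fun x : X × ℕ => f x.1 :=
  hf.comp DefinableMap.fst

end Definable

theorem DefinableMap.under : DefinableMap fun x : (X × ℕ) × ℕ => (x.1.1, x.2) :=
  (DefinableMap.fst.comp DefinableMap.fst).pair Definable.snd

namespace Definable

variable {f g b : X → ℕ}

theorem under {f : X → ℕ → ℕ} (hf : Definable fun x : X × ℕ => f x.1 x.2) :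
    Definable fun x : (X × ℕ) × ℕ => f x.1.1 x.2 :=
  hf.comp (φ := fun x : (X × ℕ) × ℕ => (x.1.1, x.2)) DefinableMap.under

theorem add (hf : Definable f) (hg : Definable g) : Definable fun x => f x + g x :=
  let ⟨e, he⟩ := hf
  let ⟨e', he'⟩ := hg
  ⟨.add e e', fun x => by simp only [Expr.eval, he, he']⟩

theorem sub (hf : Definable f) (hg : Definable g) : Definable fun x => f x - g x :=
  let ⟨e, he⟩ := hf
  let ⟨e', he'⟩ := hg
  ⟨.sub e e', fun x => by simp only [Expr.eval, he, he']⟩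

theorem one : Definable fun _ : X => 1 := ⟨.one, fun _ => rfl⟩

theorem const (c : ℕ) : Definable fun _ : X => c := by
  induction c with
  | zero => exact one.sub one
  | succ c ih => exact ih.add one

theorem sum {f : X → ℕ → ℕ} (hb : Definable b) (hf : Definable fun x : X × ℕ => f x.1 x.2) :
    Definable fun x => ∑ i ∈ Finset.range (b x), f x i :=
  let ⟨e, he⟩ := hb
  let ⟨e', he'⟩ := hf
  ⟨.sum e e', fun x => by
    simp only [Expr.eval, he]
    exact Finset.sum_congr rfl fun i _ => he' (x, i)⟩

theorem mul (hf : Definable f) (hg : Definable g) : Definable fun x => f x * g x := by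
  simpa using hf.sum (f := fun x _ => g x) hg.fst

theorem length_word : Definable fun x : X => (word x).length := ⟨.len, fun _ => rfl⟩

theorem min (hf : Definable f) (hg : Definable g) : Definable fun x => min (f x) (g x) := by
  have hmin : (fun x => Min.min (f x) (g x)) = fun x => f x - (f x - g x) := by
    funext x
    omega
  rw [hmin]
  exact hf.sub (hf.sub hg)

end Definable

namespace DefinablePred

variable {p q : X → Prop} {f g b : X → ℕ}

theorem comp {p : Y → Prop} (hp : DefinablePred p) {φ : X → Y} (hφ : DefinableMap φ) :
    DefinablePred fun x => p (φ x) :=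
  Definable.comp hp hφ

theorem under {p : X → ℕ → Prop} (hp : DefinablePred fun x : X × ℕ => p x.1 x.2) :
    DefinablePred fun x : (X × ℕ) × ℕ => p x.1.1 x.2 :=
  hp.comp (φ := fun x : (X × ℕ) × ℕ => (x.1.1, x.2)) DefinableMap.under

theorem congr (hp : DefinablePred p) (h : ∀ x, q x ↔ p x) : DefinablePred q := by
  rwa [show q = p from funext fun x => propext (h x)]

theorem const (p : Prop) : DefinablePred fun _ : X => p :=
  Definable.const _

theorem of_definable (hf : Definable f) (h : ∀ x, p x ↔ f x ≠ 0) : DefinablePred p := by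
  classical
  have hind : (fun x => if p x then 1 else 0) = fun x => 1 - (1 - f x) := by
    funext x
    have := h x
    split_ifs <;> grind
  unfold DefinablePred
  convert! Definable.one.sub (Definable.one.sub hf) using 1

theorem sym (a : Γ) (hf : Definable f) : DefinablePred fun x => (word x)[f x]? = some a :=
  let ⟨e, he⟩ := hf
  ⟨.sym a e, fun x => by simp only [Expr.eval, he]; congr⟩

theorem lt (hf : Definable f) (hg : Definable g) : DefinablePred fun x => f x < g x :=
  .of_definable (hg.sub hf) fun x => by omega

theorem le (hf : Definable f) (hg : Definable g) : DefinablePred fun x => f x ≤ g x :=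
  .of_definable ((hg.add .one).sub hf) fun x => by omega

theorem not (hp : DefinablePred p) : DefinablePred fun x => ¬p x :=
  .of_definable (Definable.one.sub hp) fun x => by split_ifs <;> simp_all

theorem and (hp : DefinablePred p) (hq : DefinablePred q) : DefinablePred fun x => p x ∧ q x :=
  .of_definable (Definable.mul hp hq) fun x => by split_ifs <;> simp_all

theorem or (hp : DefinablePred p) (hq : DefinablePred q) : DefinablePred fun x => p x ∨ q x :=
  .of_definable (Definable.add hp hq) fun x => by split_ifs <;> simp_all

theorem imp (hp : DefinablePred p) (hq : DefinablePred q) : DefinablePred fun x => p x → q x :=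
  (hp.not.or hq).congr fun _ => imp_iff_not_or

theorem iff (hp : DefinablePred p) (hq : DefinablePred q) :
    DefinablePred fun x => p x ↔ q x :=
  ((hp.imp hq).and (hq.imp hp)).congr fun _ => iff_iff_implies_and_implies

theorem eq (hf : Definable f) (hg : Definable g) : DefinablePred fun x => f x = g x :=
  ((le hf hg).and (le hg hf)).congr fun _ => le_antisymm_iff

theorem ne (hf : Definable f) (hg : Definable g) : DefinablePred fun x => f x ≠ g x :=
  (eq hf hg).not

theorem forall_mem {ι : Type} (s : Finset ι) {p : ι → X → Prop}
    (hp : ∀ i, DefinablePred (p i)) : DefinablePred fun x => ∀ i ∈ s, p i x := by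
  classical
  induction s using Finset.induction_on with
  | empty => exact (const True).congr fun x => by simp
  | insert i s _ ih => exact ((hp i).and ih).congr fun x => Finset.forall_mem_insert ..

end DefinablePred

theorem Definable.ite {p : X → Prop} {_ : ∀ x, Decidable (p x)} {f g : X → ℕ}
    (hp : DefinablePred p) (hf : Definable f) (hg : Definable g) :
    Definable fun x => if p x then f x else g x := by
  convert! (Definable.mul hp hf).add (Definable.mul hp.not hg) using 2 with x
  by_cases h : p x <;> simp [h]

theorem Definable.count {b : X → ℕ} {p : X → ℕ → Prop} {dec : ∀ x i, Decidable (p x i)}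
    (hb : Definable b) (hp : DefinablePred fun x : X × ℕ => p x.1 x.2) :
    Definable fun x => ((Finset.range (b x)).filter (p x)).card := by
  convert! hb.sum (f := fun x i => if p x i then 1 else 0) (.ite hp .one (.const 0)) using 2
  rw [Finset.card_filter]

theorem DefinablePred.exists_lt {b : X → ℕ} {p : X → ℕ → Prop} (hb : Definable b)
    (hp : DefinablePred fun x : X × ℕ => p x.1 x.2) : DefinablePred fun x => ∃ i < b x, p x i := by
  classical
  exact .of_definable (.count (dec := fun _ _ => inferInstance) hb hp) fun x => by
    simp [Finset.filter_eq_empty_iff]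

theorem DefinablePred.forall_lt {b : X → ℕ} {p : X → ℕ → Prop} (hb : Definable b)
    (hp : DefinablePred fun x : X × ℕ => p x.1 x.2) : DefinablePred fun x => ∀ i < b x, p x i :=
  (exists_lt (p := fun x i => ¬p x i) hb hp.not).not.congr fun x => by simp

omit [DecidableEq Γ] in
theorem length_flatMap_range (s : ℕ → List Γ) (b : ℕ) :
    ((List.range b).flatMap s).length = ∑ j ∈ Finset.range b, (s j).length := by
  induction b with
  | zero => simp
  | succ b ih =>
    rw [List.range_succ, List.flatMap_append, List.flatMap_singleton, List.length_append, ih,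
      Finset.sum_range_succ]

omit [DecidableEq Γ] in
theorem getElem?_flatMap_range (s : ℕ → List Γ) (a : Γ) (b p : ℕ) :
    ((List.range b).flatMap s)[p]? = some a ↔ ∃ i < b,
      ∑ j ∈ Finset.range i, (s j).length ≤ p ∧
        (s i)[p - ∑ j ∈ Finset.range i, (s j).length]? = some a := by
  induction b with
  | zero => simp
  | succ b ih =>
    rw [List.range_succ, List.flatMap_append, List.flatMap_singleton, Nat.exists_lt_succ_right]
    rcases lt_or_ge p (∑ j ∈ Finset.range b, (s j).length) with hp | hp
    · rw [List.getElem?_append_left (by rwa [length_flatMap_range]), ih]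
      simp only [not_le.2 hp, false_and, or_false]
    · rw [List.getElem?_append_right (by rwa [length_flatMap_range]), length_flatMap_range]
      refine ⟨fun ha => .inr ⟨hp, ha⟩, ?_⟩
      rintro (⟨i, hi, hle, ha⟩ | ⟨-, ha⟩)
      · have hlt := (List.getElem?_eq_some_iff.1 ha).1
        have hsum : ∑ j ∈ Finset.range (i + 1), (s j).length ≤
            ∑ j ∈ Finset.range b, (s j).length :=
          Finset.sum_le_sum_of_subset (Finset.range_subset_range.2 hi)
        rw [Finset.sum_range_succ] at hsum
        omega
      · exact ha

namespace DefinableWord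

variable {s t : X → List Γ}

theorem comp {s : Y → List Γ} (hs : DefinableWord s) {φ : X → Y} (hφ : DefinableMap φ) :
    DefinableWord fun x => s (φ x) :=
  ⟨hs.length.comp hφ, fun a => (hs.symbol a).comp (φ := fun x : X × ℕ => (φ x.1, x.2))
    ((hφ.comp .fst).pair .snd)⟩

theorem word : DefinableWord fun x : X => Context.word x :=
  ⟨.length_word, fun a => DefinablePred.sym (X := X × ℕ) a .snd⟩

theorem replicate (b : Γ) {f : X → ℕ} (hf : Definable f) :
    DefinableWord fun x => List.replicate (f x) b := by
  refine ⟨by simpa only [List.length_replicate] using hf, fun a => ?_⟩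
  exact ((DefinablePred.lt .snd hf.fst).and (.const (b = a))).congr fun x => by
    simp [List.getElem?_replicate]

theorem append (hs : DefinableWord s) (ht : DefinableWord t) :
    DefinableWord fun x => s x ++ t x := by
  refine ⟨by simpa only [List.length_append] using hs.length.add ht.length, fun a => ?_⟩
  have hright : DefinablePred fun x : X × ℕ => (t x.1)[x.2 - (s x.1).length]? = some a :=
    (ht.symbol a).comp (φ := fun x : X × ℕ => (x.1, x.2 - (s x.1).length))
      (.pair .fst (Definable.snd.sub hs.length.fst))
  refine (((DefinablePred.lt .snd hs.length.fst).and (hs.symbol a)).or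
    ((DefinablePred.le hs.length.fst .snd).and hright)).congr fun x => ?_
  rcases lt_or_ge x.2 (s x.1).length with hx | hx
  · simp [hx, List.getElem?_append_left hx, not_le.2 hx]
  · simp [hx, List.getElem?_append_right hx, not_lt.2 hx]

theorem const (l : List Γ) : DefinableWord fun _ : X => l := by
  induction l with
  | nil => exact ⟨.const 0, fun a => (DefinablePred.const False).congr fun x => by simp⟩
  | cons a l ih => simpa using (replicate (X := X) a .one).append ih

theorem flatMap {b : X → ℕ} {s : X → ℕ → List Γ} (hb : Definable b)
    (hs : DefinableWord fun x : X × ℕ => s x.1 x.2) :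
    DefinableWord fun x => (List.range (b x)).flatMap (s x) := by
  refine ⟨by simpa only [length_flatMap_range] using hb.sum hs.length, fun a => ?_⟩
  have hoffset : Definable fun x : (X × ℕ) × ℕ =>
      ∑ j ∈ Finset.range x.2, (s x.1.1 j).length :=
    Definable.snd.sum (Definable.under (f := fun (x : X × ℕ) j => (s x.1 j).length)
      (Definable.under (f := fun x j => (s x j).length) hs.length))
  have hsymbol : DefinablePred fun x : (X × ℕ) × ℕ =>
      (s x.1.1 x.2)[x.1.2 - ∑ j ∈ Finset.range x.2, (s x.1.1 j).length]? = some a :=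
    (hs.symbol a).comp (φ := fun x : (X × ℕ) × ℕ =>
      ((x.1.1, x.2), x.1.2 - ∑ j ∈ Finset.range x.2, (s x.1.1 j).length))
      (.pair .under (Definable.snd.fst.sub hoffset))
  exact (DefinablePred.exists_lt hb.fst (p := fun x i =>
    ∑ j ∈ Finset.range i, (s x.1 j).length ≤ x.2 ∧
      (s x.1 i)[x.2 - ∑ j ∈ Finset.range i, (s x.1 j).length]? = some a)
    ((DefinablePred.le hoffset Definable.snd.fst).and hsymbol)).congr fun x =>
      getElem?_flatMap_range _ _ _ _

end DefinableWord

variable [Finite Γ]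

theorem DefinablePred.word_eq {s t : X → List Γ} (hs : DefinableWord s) (ht : DefinableWord t) :
    DefinablePred fun x => s x = t x := by
  have := Fintype.ofFinite Γ
  have hsymbols : DefinablePred fun x => ∀ i < (s x).length, ∀ a ∈ Finset.univ,
      ((s x)[i]? = some a ↔ (t x)[i]? = some a) :=
    .forall_lt (p := fun x i => ∀ a ∈ Finset.univ, ((s x)[i]? = some a ↔ (t x)[i]? = some a))
      hs.length (.forall_mem _ fun a => (hs.symbol a).iff (ht.symbol a))
  refine ((DefinablePred.eq hs.length ht.length).and hsymbols).congr fun x =>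
    ⟨fun h => by simp [h], fun ⟨hlen, h⟩ => List.ext_getElem hlen fun i hi hi' => ?_⟩
  have hi := (h i hi _ (Finset.mem_univ _)).1 (List.getElem?_eq_getElem hi)
  exact (Option.some_injective _ ((List.getElem?_eq_getElem hi').symm.trans hi)).symm

theorem DefinablePred.inP [Inhabited Γ] {L : Language Γ}
    (h : DefinablePred fun w : List Γ => w ∈ L) : InP L :=
  let ⟨e, he⟩ := h
  Expr.inP e (fun w hw => (he w).trans (by simp [hw])) (fun w hw => (he w).trans (by simp [hw]))

end Definability

/-! ### A numerical criterion for manipulation -/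

section Winner

variable {m n : ℕ}

theorem topCount_mono (V : Profile m n) (c : Fin m) {l l' : ℕ} (h : l ≤ l') :
    topCount V c l ≤ topCount V c l' :=
  Finset.card_le_card (Finset.monotone_filter_right _ fun _ _ hi => hi.trans_le h)

theorem topCount_zero (V : Profile m n) (c : Fin m) : topCount V c 0 = 0 := by
  simp [topCount]

theorem topCount_numCand (V : Profile m n) (c : Fin m) : topCount V c m = n := by
  simp [topCount]

theorem bucklinScore_le_iff (V : Profile m n) (c : Fin m) (l : ℕ) :
    bucklinScore V c ≤ l ↔ n ≤ 2 * topCount V c l := by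
  refine ⟨fun h => ?_, fun h => Nat.sInf_le h⟩
  have hne : {l : ℕ | n ≤ 2 * topCount V c l}.Nonempty :=
    ⟨m, by simp only [Set.mem_ofPred_eq, topCount_numCand]; omega⟩
  exact (Nat.sInf_mem hne).trans (Nat.mul_le_mul_left 2 (topCount_mono V c h))

theorem lt_bucklinScore_iff (V : Profile m n) (c : Fin m) (l : ℕ) :
    l < bucklinScore V c ↔ 2 * topCount V c l < n := by
  rw [← not_le, bucklinScore_le_iff, not_le]

theorem lexTieBreak_eq_iff (t : Preference m) {S : Finset (Fin m)} (hS : S.Nonempty) (y : Fin m) :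
    lexTieBreak t S hS = y ↔ y ∈ S ∧ ∀ d ∈ S, ¬ t.Prefers d y := by
  unfold lexTieBreak Preference.Prefers
  rw [← Equiv.eq_symm_apply, Finset.min'_eq_iff]
  simp only [Finset.mem_image, EmbeddingLike.apply_eq_iff_eq, exists_eq_right, not_lt,
    forall_exists_index, and_imp, forall_apply_eq_imp_iff₂]

theorem bucklin_eq_iff_bucklinScore [NeZero m] (t : Preference m) (V : Profile m n) (y : Fin m) :
    bucklin m n t V = y ↔ ∀ d ≠ y, bucklinScore V y ≤ bucklinScore V d ∧
      (t.Prefers d y → bucklinScore V y < bucklinScore V d) := by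
  unfold bucklin
  simp only [lexTieBreak_eq_iff, bucklinWinners, Finset.mem_filter, Finset.mem_univ, true_and]
  constructor
  · rintro ⟨hy, ht⟩ d -
    exact ⟨hy d, fun hdy => lt_of_not_ge fun h => ht d (fun e => h.trans (hy e)) hdy⟩
  · refine fun h => ⟨fun d => ?_, fun d hd hdy => ?_⟩
    · rcases eq_or_ne d y with rfl | hdy
      · exact le_rfl
      · exact (h d hdy).1
    · have hne : d ≠ y := by
        rintro rfl
        exact lt_irrefl _ hdy
      exact ((h d hne).2 hdy).not_ge (hd y)

theorem bucklin_eq_iff [NeZero m] (hn : 0 < n) (t : Preference m) (V : Profile m n) (y : Fin m) :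
    bucklin m n t V = y ↔ ∃ l < m, n ≤ 2 * topCount V y (l + 1) ∧
      ∀ d, d ≠ y → 2 * topCount V d l < n ∧ (t.Prefers d y → 2 * topCount V d (l + 1) < n) := by
  rw [bucklin_eq_iff_bucklinScore]
  simp only [← bucklinScore_le_iff, ← lt_bucklinScore_iff]
  constructor
  · intro h
    have hpos : 0 < bucklinScore V y := by
      rw [lt_bucklinScore_iff, topCount_zero]
      omega
    have hle : bucklinScore V y ≤ m := by
      rw [bucklinScore_le_iff, topCount_numCand]
      omega
    refine ⟨bucklinScore V y - 1, by omega, by omega, fun d hd => ?_⟩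
    obtain ⟨hle, hlt⟩ := h d hd
    exact ⟨by omega, fun hdy => by have := hlt hdy; omega⟩
  · rintro ⟨l, -, hy, h⟩ d hd
    obtain ⟨hle, hlt⟩ := h d hd
    exact ⟨by omega, fun hdy => by have := hlt hdy; omega⟩

end Winner

section Deal

variable {ι J : Type*}

theorem exists_sum_eq (s : Finset ι) (lo hi : ι → ℕ) (h : ∀ i ∈ s, lo i ≤ hi i) (U : ℕ)
    (hlo : ∑ i ∈ s, lo i ≤ U) (hhi : U ≤ ∑ i ∈ s, hi i) :
    ∃ u : ι → ℕ, (∀ i ∈ s, lo i ≤ u i ∧ u i ≤ hi i) ∧ ∑ i ∈ s, u i = U := by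
  classical
  induction s using Finset.induction_on generalizing U with
  | empty => exact ⟨lo, by simp, by simp at hhi ⊢; omega⟩
  | insert a s ha ih =>
    rw [Finset.sum_insert ha] at hlo hhi
    have hs : ∀ i ∈ s, lo i ≤ hi i := fun i hi => h i (Finset.mem_insert_of_mem hi)
    have hsum_le := Finset.sum_le_sum hs
    have hloa := h a (Finset.mem_insert_self a s)
    set ua := min (hi a) (U - ∑ i ∈ s, lo i)
    obtain ⟨u, hu, hsum⟩ := ih hs (U - ua) (by omega) (by omega)
    have hupdate : ∀ i ∈ s, Function.update u a ua i = u i := fun i hi =>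
      Function.update_of_ne (ne_of_mem_of_not_mem hi ha) _ _
    refine ⟨Function.update u a ua, fun i hi => ?_, ?_⟩
    · rcases Finset.mem_insert.1 hi with rfl | hi
      · rw [Function.update_self]
        omega
      · rw [hupdate i hi]
        exact hu i hi
    · rw [Finset.sum_insert ha, Function.update_self, Finset.sum_congr rfl hupdate, hsum]
      omega

/-- Capacities `c` suffice for two demands `U` and `V` if they suffice for each of them and for
both together, where at most `p i` (respectively `q i`) units of `i` can be used. -/
def Suffices (s : Finset ι) (c p q : ι → ℕ) (U V : ℕ) : Prop :=
  U ≤ ∑ i ∈ s, min (c i) (p i) ∧ V ≤ ∑ i ∈ s, min (c i) (q i) ∧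
    U + V ≤ ∑ i ∈ s, min (c i) (p i + q i)

namespace Suffices

variable {s : Finset ι} {c p q : ι → ℕ} {U V : ℕ}

theorem of_exists {u v : ι → ℕ} (h : ∀ i ∈ s, u i ≤ p i ∧ v i ≤ q i ∧ u i + v i ≤ c i)
    (hU : U ≤ ∑ i ∈ s, u i) (hV : V ≤ ∑ i ∈ s, v i) : Suffices s c p q U V := by
  refine ⟨hU.trans (Finset.sum_le_sum fun i hi => ?_), hV.trans (Finset.sum_le_sum fun i hi => ?_),
    (add_le_add hU hV).trans ?_⟩
  · have := h i hi
    omega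
  · have := h i hi
    omega
  · rw [← Finset.sum_add_distrib]
    refine Finset.sum_le_sum fun i hi => ?_
    have := h i hi
    omega

/-- The first demand is served preferably by the surplus `min c (p + q) - q`, whose use does not
lower what is left for the second demand. -/
theorem exists_first (h : Suffices s c p q U V) :
    ∃ u : ι → ℕ, (∀ i ∈ s, u i ≤ min (c i) (p i)) ∧ ∑ i ∈ s, u i = U ∧
      V ≤ ∑ i ∈ s, min (c i - u i) (q i) := by
  obtain ⟨hU, hV, hUV⟩ := h
  rcases le_or_gt (∑ i ∈ s, (min (c i) (p i + q i) - q i)) U with hlo | hlo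
  · obtain ⟨u, hu, hsum⟩ := exists_sum_eq s (fun i => min (c i) (p i + q i) - q i)
      (fun i => min (c i) (p i)) (fun i _ => by omega) U hlo hU
    have hrest : ∑ i ∈ s, min (c i) (p i + q i) ≤
        ∑ i ∈ s, u i + ∑ i ∈ s, min (c i - u i) (q i) := by
      rw [← Finset.sum_add_distrib]
      refine Finset.sum_le_sum fun i hi => ?_
      have := hu i hi
      omega
    exact ⟨u, fun i hi => (hu i hi).2, hsum, by omega⟩
  · obtain ⟨u, hu, hsum⟩ := exists_sum_eq s (fun _ => 0) (fun i => min (c i) (p i + q i) - q i)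
      (fun i _ => Nat.zero_le _) U (by simp) hlo.le
    refine ⟨u, fun i hi => ?_, hsum, hV.trans (Finset.sum_le_sum fun i hi => ?_)⟩
    · have := hu i hi
      omega
    · have := hu i hi
      omega

theorem exists_split (h : Suffices s c p q U V) :
    ∃ u v : ι → ℕ, (∀ i ∈ s, u i ≤ p i ∧ v i ≤ q i ∧ u i + v i ≤ c i) ∧
      ∑ i ∈ s, u i = U ∧ ∑ i ∈ s, v i = V := by
  obtain ⟨u, hu, husum, hV⟩ := h.exists_first
  obtain ⟨v, hv, hvsum⟩ := exists_sum_eq s (fun _ => 0) (fun i => min (c i - u i) (q i))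
    (fun _ _ => Nat.zero_le _) V (by simp) hV
  refine ⟨u, v, fun i hi => ?_, husum, hvsum⟩
  have := hu i hi
  have := hv i hi
  omega

end Suffices

theorem exists_subset_card_eq_forall_le (P : Finset J) (f : J → ℕ) {u : ℕ} (hu : u ≤ P.card) :
    ∃ B ⊆ P, B.card = u ∧ ∀ i ∈ B, ∀ j ∈ P, j ∉ B → f i ≤ f j := by
  classical
  induction u with
  | zero => exact ⟨∅, by simp⟩
  | succ u ih =>
    obtain ⟨B, hBP, hBu, hB⟩ := ih (by omega)
    have hne : (P \ B).Nonempty := by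
      rw [← Finset.card_pos, Finset.card_sdiff_of_subset hBP]
      omega
    obtain ⟨a, ha, hmin⟩ := Finset.exists_min_image (P \ B) f hne
    rw [Finset.mem_sdiff] at ha
    refine ⟨insert a B, Finset.insert_subset ha.1 hBP, by
      rw [Finset.card_insert_of_notMem ha.2, hBu], fun i hi j hj hjB => ?_⟩
    rw [Finset.mem_insert, not_or] at hjB
    rcases Finset.mem_insert.1 hi with rfl | hi
    · exact hmin j (Finset.mem_sdiff.2 ⟨hj, hjB.2⟩)
    · exact hB i hi j hj hjB.2

/-- The sizes of the sets `A j` for `j ∈ P` differ by at most one. -/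
def Balanced (P : Finset J) (A : J → Finset ι) : Prop :=
  ∀ i ∈ P, ∀ j ∈ P, (A i).card ≤ (A j).card + 1

namespace Balanced

variable {P : Finset J} {A : J → Finset ι}

theorem le_card (h : Balanced P A) {a : ℕ} (hs : P.card * a ≤ ∑ j ∈ P, (A j).card) :
    ∀ j ∈ P, a ≤ (A j).card := by
  intro j hj
  by_contra hlt
  have hsum : ∑ i ∈ P, (A i).card < ∑ _i ∈ P, a :=
    Finset.sum_lt_sum (fun i hi => by have := h i hi j hj; omega) ⟨j, hj, by omega⟩
  rw [Finset.sum_const, smul_eq_mul] at hsum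
  omega

theorem card_le (h : Balanced P A) {b : ℕ} (hs : ∑ j ∈ P, (A j).card ≤ P.card * b) :
    ∀ j ∈ P, (A j).card ≤ b := by
  intro j hj
  by_contra hlt
  have hsum : ∑ _i ∈ P, b < ∑ i ∈ P, (A i).card :=
    Finset.sum_lt_sum (fun i hi => by have := h j hj i hi; omega) ⟨j, hj, by omega⟩
  rw [Finset.sum_const, smul_eq_mul] at hsum
  omega

variable [DecidableEq ι] {S : Finset ι}

theorem insert (h : Balanced P A) (hA : ∀ j ∈ P, A j ⊆ S) {d : ι} (hd : d ∉ S) {u : ℕ}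
    (hu : u ≤ P.card) : ∃ B : J → Finset ι, Balanced P B ∧
      (∀ j ∈ P, B j ⊆ Insert.insert d S ∧ B j ∩ S = A j) ∧
      (P.filter fun j => d ∈ B j).card = u := by
  classical
  obtain ⟨R, hRP, hRu, hR⟩ := exists_subset_card_eq_forall_le P (fun j => (A j).card) hu
  have hdA : ∀ j ∈ P, d ∉ A j := fun j hj hdj => hd (hA j hj hdj)
  have hcard : ∀ j ∈ P, (Insert.insert d (A j)).card = (A j).card + 1 := fun j hj =>
    Finset.card_insert_of_notMem (hdA j hj)
  refine ⟨fun j => if j ∈ R then Insert.insert d (A j) else A j, fun i hi j hj => ?_,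
    fun j hj => ?_, ?_⟩
  · have hij := h i hi j hj
    have hmin := fun hiR => hR i hiR j hj
    dsimp only
    split_ifs with hiR hjR hjR
    · rw [hcard i hi, hcard j hj]
      omega
    · rw [hcard i hi]
      exact Nat.succ_le_succ (hmin hiR hjR)
    · rw [hcard j hj]
      omega
    · exact hij
  · dsimp only
    split_ifs
    · exact ⟨Finset.insert_subset_insert _ (hA j hj), by
        rw [Finset.insert_inter_of_notMem hd, Finset.inter_eq_left.2 (hA j hj)]⟩
    · exact ⟨(hA j hj).trans (Finset.subset_insert _ _), Finset.inter_eq_left.2 (hA j hj)⟩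
  · rw [← hRu]
    congr 1
    ext j
    simp only [Finset.mem_filter]
    refine ⟨fun ⟨hj, hdj⟩ => ?_, fun hj => ⟨hRP hj, by simp [hj]⟩⟩
    by_contra hjR
    exact hdA j hj (by simpa only [if_neg hjR] using hdj)

theorem extend (h : Balanced P A) (hA : ∀ j ∈ P, A j ⊆ S) (u : ι → ℕ) (T : Finset ι)
    (hST : Disjoint S T) (hu : ∀ d ∈ T, u d ≤ P.card) :
    ∃ B : J → Finset ι, Balanced P B ∧ (∀ j ∈ P, B j ⊆ S ∪ T ∧ B j ∩ S = A j) ∧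
      ∀ d ∈ T, (P.filter fun j => d ∈ B j).card = u d := by
  induction T using Finset.induction_on with
  | empty =>
    exact ⟨A, h, fun j hj => ⟨by simpa using hA j hj, Finset.inter_eq_left.2 (hA j hj)⟩, by simp⟩
  | insert a T ha ih =>
    rw [Finset.disjoint_insert_right] at hST
    obtain ⟨B, hB, hBA, hBu⟩ := ih hST.2 fun d hd => hu d (Finset.mem_insert_of_mem hd)
    obtain ⟨C, hC, hCB, hCu⟩ := hB.insert (fun j hj => (hBA j hj).1) (d := a) (by simp [hST.1, ha])
      (hu a (Finset.mem_insert_self a T))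
    refine ⟨C, hC, fun j hj => ⟨?_, ?_⟩, fun d hd => ?_⟩
    · rw [Finset.union_insert]
      exact (hCB j hj).1
    · rw [← (hBA j hj).2, ← (hCB j hj).2, Finset.inter_assoc,
        Finset.inter_eq_right.2 Finset.subset_union_left]
    · rcases Finset.mem_insert.1 hd with rfl | hd
      · exact hCu
      · rw [← hBu d hd]
        refine congrArg Finset.card (Finset.filter_congr fun j hj => ?_)
        rw [← (hCB j hj).2]
        simp [hd]

end Balanced

variable [DecidableEq ι] {W S : Finset ι}

theorem sum_card_eq_sum_degree (P : Finset J) (A : J → Finset ι) (hA : ∀ j ∈ P, A j ⊆ S) :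
    ∑ j ∈ P, (A j).card = ∑ d ∈ S, (P.filter fun j => d ∈ A j).card := by
  refine (Finset.sum_congr rfl fun j hj => ?_).trans
    (Finset.sum_card_bipartiteAbove_eq_sum_card_bipartiteBelow fun j d => d ∈ A j)
  rw [Finset.bipartiteAbove, Finset.filter_mem_eq_inter, Finset.inter_eq_right.2 (hA j hj)]

theorem exists_balanced (P : Finset J) (hWS : W ⊆ S) (u : ι → ℕ) (hu : ∀ d ∈ S, u d ≤ P.card) :
    ∃ A : J → Finset ι, Balanced P A ∧ (Balanced P fun j => A j ∩ W) ∧ (∀ j ∈ P, A j ⊆ S) ∧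
      ∀ d ∈ S, (P.filter fun j => d ∈ A j).card = u d := by
  obtain ⟨A, hA, hAW, hAu⟩ := Balanced.extend (P := P) (S := ∅) (A := fun _ => ∅)
    (fun i _ j _ => by simp) (by simp) u W (by simp) fun d hd => hu d (hWS hd)
  simp only [Finset.empty_union] at hAW
  obtain ⟨B, hB, hBA, hBu⟩ := hA.extend (fun j hj => (hAW j hj).1) u (S \ W)
    Finset.disjoint_sdiff fun d hd => hu d (Finset.mem_sdiff.1 hd).1
  rw [Finset.union_sdiff_of_subset hWS] at hBA
  refine ⟨B, hB, fun i hi j hj => ?_, fun j hj => (hBA j hj).1, fun d hd => ?_⟩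
  · simp only [(hBA i hi).2, (hBA j hj).2]
    exact hA i hi j hj
  · by_cases hdW : d ∈ W
    · rw [← hAu d hdW]
      refine congrArg Finset.card (Finset.filter_congr fun j hj => ?_)
      rw [← (hBA j hj).2]
      simp [hdW]
    · exact hBu d (Finset.mem_sdiff.2 ⟨hd, hdW⟩)

/-- Deal the elements of `S` so that both all of them and those of `W` are balanced; `T j` adds all
of `W` to the share `A j`, which is a proper extension as no share contains the whole of `W`. -/
theorem exists_deal (P : Finset J) (hWS : W ⊆ S) (u : ι → ℕ) (s U : ℕ)
    (hu : ∀ d ∈ S, u d ≤ P.card) (hU : U ≤ P.card * s) (hUW : U ≤ P.card * W.card)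
    (hW : ∑ d ∈ W, u d = U - P.card) (hS : ∑ d ∈ S \ W, u d = P.card * s - U) :
    ∃ A T : J → Finset ι, (∀ j ∈ P, A j ⊆ T j ∧ T j ⊆ S ∧ s ≤ (A j).card + 1 ∧ s ≤ (T j).card) ∧
      (∀ d ∈ W, (P.filter fun j => d ∈ A j).card ≤ u d) ∧
      ∀ d ∈ S \ W, (P.filter fun j => d ∈ T j).card ≤ u d := by
  rcases Nat.eq_zero_or_pos s with rfl | hs
  · exact ⟨fun _ => ∅, fun _ => ∅, by simp, by simp, by simp⟩
  obtain ⟨A, hA, hAW, hAS, hAu⟩ := exists_balanced P hWS u hu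
  have hsum : ∑ j ∈ P, (A j).card = P.card * s - U + (U - P.card) := by
    rw [sum_card_eq_sum_degree P A hAS, Finset.sum_congr rfl hAu, ← Finset.sum_sdiff hWS, hS, hW]
  rcases W.eq_empty_or_nonempty with rfl | hne
  · simp only [Finset.card_empty, mul_zero, Nat.le_zero] at hUW
    have hcard := hA.le_card (a := s) (by omega)
    exact ⟨A, A, fun j hj => ⟨subset_rfl, hAS j hj, (hcard j hj).trans (Nat.le_succ _), hcard j hj⟩,
      by simp, fun d hd => (hAu d (Finset.mem_sdiff.1 hd).1).le⟩
  have hWpos := hne.card_pos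
  have hmul_pred : ∀ k, P.card * (k - 1) = P.card * k - P.card := fun k => by
    rw [Nat.mul_sub, mul_one]
  have hsumW : ∑ j ∈ P, (A j ∩ W).card = U - P.card := by
    rw [sum_card_eq_sum_degree P _ (fun j _ => Finset.inter_subset_right), ← hW]
    refine Finset.sum_congr rfl fun d hd => ?_
    rw [← hAu d (hWS hd)]
    simp only [Finset.mem_inter, hd, and_true]
  refine ⟨A, fun j => A j ∪ W, fun j hj => ?_, fun d hd => (hAu d (hWS hd)).le, fun d hd => ?_⟩
  · have hle : s - 1 ≤ (A j).card := hA.le_card (by rw [hmul_pred]; omega) j hj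
    have hleW : (A j ∩ W).card ≤ W.card - 1 := hAW.card_le (by rw [hmul_pred]; omega) j hj
    have := Finset.card_union_add_card_inter (A j) W
    exact ⟨Finset.subset_union_left, Finset.union_subset (hAS j hj) hWS, by omega,
      show s ≤ (A j ∪ W).card by omega⟩
  · rw [Finset.mem_sdiff] at hd
    rw [← hAu d hd.1]
    simp [hd.2]

end Deal

section Vote

variable {m : ℕ} {f : Fin m → ℕ} {B : Finset (Fin m)} {d : Fin m} {k s : ℕ}

theorem sort_prefers {a b : Fin m} (h : f a < f b) : Preference.Prefers (Tuple.sort f) a b := by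
  by_contra hlt
  have := Tuple.monotone_sort f (not_lt.1 hlt)
  simp only [Function.comp, Equiv.apply_symm_apply] at this
  omega

theorem le_of_sort_symm_lt (hB : ∀ c ∈ B, f c ≤ k) (hs : s ≤ B.card)
    (hd : ((Tuple.sort f).symm d : ℕ) < s) : f d ≤ k := by
  by_contra hlt
  have hcard : B.card ≤ (Finset.Iio ((Tuple.sort f).symm d)).card := by
    refine Finset.card_le_card_of_injOn (Tuple.sort f).symm (fun c hc => ?_)
      (Tuple.sort f).symm.injective.injOn
    rw [Finset.coe_Iio, Set.mem_Iio]
    exact sort_prefers ((hB c hc).trans_lt (not_le.1 hlt))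
  rw [Fin.card_Iio] at hcard
  omega

theorem sort_symm_lt (hB : ∀ c, f c ≤ f d → c ∈ B) (hs : B.card ≤ s) :
    ((Tuple.sort f).symm d : ℕ) < s := by
  have hcard : (Finset.Iic ((Tuple.sort f).symm d)).card ≤ B.card := by
    refine Finset.card_le_card_of_injOn (Tuple.sort f) (fun c hc => hB _ ?_)
      (Tuple.sort f).injective.injOn
    have := Tuple.monotone_sort f (show c ≤ (Tuple.sort f).symm d by simpa using hc)
    simpa using this
  rw [Fin.card_Iic] at hcard
  omega

theorem exists_vote_bot {x y : Fin m} (hxy : x ≠ y) {A T : Finset (Fin m)} {l : ℕ} (hAT : A ⊆ T)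
    (hy : y ∉ T) (hA : l ≤ A.card) (hT : l + 1 ≤ T.card) :
    ∃ p : Preference m, p.Prefers x y ∧ ∀ d, d ≠ y →
      ((p.symm d : ℕ) < l → d ∈ A) ∧ ((p.symm d : ℕ) < l + 1 → d ∈ T) := by
  let f : Fin m → ℕ := fun d => if d = y then 3 else if d ∈ A then 0 else if d ∈ T then 1 else 2
  have hle_zero : ∀ d, f d ≤ 0 ↔ d ∈ A := by grind
  have hle_one : ∀ d, f d ≤ 1 ↔ d ∈ T := by grind
  exact ⟨Tuple.sort f, sort_prefers (by grind), fun d _ =>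
    ⟨fun h => (hle_zero d).1 (le_of_sort_symm_lt (fun c => (hle_zero c).2) hA h),
      fun h => (hle_one d).1 (le_of_sort_symm_lt (fun c => (hle_one c).2) hT h)⟩⟩

theorem exists_vote_top {x y : Fin m} (hxy : x ≠ y) {A T : Finset (Fin m)} {l : ℕ} (hAT : A ⊆ T)
    (hx : x ∉ T) (hy : y ∉ T) (hl : 0 < l) (hA : l ≤ A.card + 2) (hT : l ≤ T.card + 1) :
    ∃ p : Preference m, p.Prefers x y ∧ (p.symm y : ℕ) < l + 1 ∧ ∀ d, d ≠ y → d ≠ x →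
      ((p.symm d : ℕ) < l → d ∈ A) ∧ ((p.symm d : ℕ) < l + 1 → d ∈ T) := by
  let f : Fin m → ℕ := fun d => if d = x then 0 else if d = y then 1 else if d ∈ A then 2 else
    if d ∈ T then 3 else 4
  have hcard : ∀ B ⊆ T, (insert x (insert y B)).card = B.card + 2 := fun B hB => by
    rw [Finset.card_insert_of_notMem (by grind), Finset.card_insert_of_notMem (by grind)]
  have hle_one : ∀ c, f c ≤ f y → c ∈ ({x, y} : Finset (Fin m)) := by grind
  have hle_two : ∀ d, f d ≤ 2 ↔ d ∈ insert x (insert y A) := by grind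
  have hle_three : ∀ d, f d ≤ 3 ↔ d ∈ insert x (insert y T) := by grind
  refine ⟨Tuple.sort f, sort_prefers (by grind),
    sort_symm_lt hle_one (Finset.card_le_two.trans (by omega)), fun d hdy hdx => ⟨fun h => ?_,
      fun h => ?_⟩⟩
  · have := (hle_two d).1 (le_of_sort_symm_lt (fun c => (hle_two c).2) (by grind) h)
    simpa [hdx, hdy] using this
  · have := (hle_three d).1 (le_of_sort_symm_lt (fun c => (hle_three c).2) (by grind) h)
    simpa [hdx, hdy] using this

end Vote

section Criterion

variable {m n : ℕ} {J : Type*}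

/-- The number of voters outside of `M` that rank `c` in their top `l` positions. -/
def outCount (V : Profile m n) (M : Finset (Fin n)) (c : Fin m) (l : ℕ) : ℕ :=
  (Finset.univ.filter fun i : Fin n => i ∉ M ∧ ((V i).symm c : ℕ) < l).card

theorem topCount_piecewise (V W : Profile m n) (M : Finset (Fin n)) (c : Fin m) (l : ℕ) :
    topCount (M.piecewise W V) c l =
      outCount V M c l + (M.filter fun j => ((W j).symm c : ℕ) < l).card := by
  unfold topCount outCount
  rw [← Finset.card_union_of_disjoint]
  · congr 1
    ext i
    by_cases hi : i ∈ M <;> simp [hi]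
  · refine Finset.disjoint_left.2 fun i hi hi' => ?_
    simp only [Finset.mem_filter, Finset.mem_univ, true_and] at hi hi'
    exact hi.1 hi'.1

instance (t : Preference m) (a b : Fin m) : Decidable (t.Prefers a b) :=
  inferInstanceAs (Decidable (t.symm a < t.symm b))

theorem not_prefers_self (t : Preference m) (y : Fin m) : ¬ t.Prefers y y := lt_irrefl _

/-- If `y` wins with a top segment of length `l + 1`, then a candidate `d` may not be contained in
the top segments of this length of half of the voters. -/
def threshold (t : Preference m) (y : Fin m) (l : ℕ) (d : Fin m) : ℕ :=
  if t.Prefers d y then l + 1 else l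

theorem bucklin_eq_iff_threshold [NeZero m] (hn : 0 < n) (t : Preference m) (V : Profile m n)
    (y : Fin m) : bucklin m n t V = y ↔ ∃ l < m, n ≤ 2 * topCount V y (l + 1) ∧
      ∀ d, d ≠ y → 2 * topCount V d (threshold t y l d) < n := by
  rw [bucklin_eq_iff hn]
  refine exists_congr fun l => and_congr_right fun _ => and_congr_right fun _ =>
    forall₂_congr fun d _ => ?_
  have hmono := topCount_mono V d (Nat.le_add_right l 1)
  by_cases hdy : t.Prefers d y
  · simp only [threshold, hdy, if_true, true_imp_iff]
    omega
  · simp only [threshold, hdy, if_false, false_imp_iff, and_true]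

/-- The candidates which lose a tie against `y`. -/
def weakRivals (t : Preference m) (y : Fin m) : Finset (Fin m) :=
  Finset.univ.filter fun d => d ≠ y ∧ ¬ t.Prefers d y

/-- The candidates which win a tie against `y`. -/
def strongRivals (t : Preference m) (y : Fin m) : Finset (Fin m) :=
  Finset.univ.filter fun d => t.Prefers d y

/-- The support of the candidate `d` caused by the voters outside of `M` and by `τ` manipulators
that rank `y`, and thus `x`, high. -/
def load (t : Preference m) (V : Profile m n) (M : Finset (Fin n)) (x y : Fin m) (l τ : ℕ)
    (d : Fin m) : ℕ :=
  outCount V M d (threshold t y l d) + if d = x then τ else 0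

/-- The numerical criterion for the existence of a manipulation after which `y` wins with a top
segment of length `l + 1`, and `τ` manipulators have `y` in their top segment. The members of the
other `M.card - τ` top segments that are weak rivals number `U`, and the members of the `τ` top
segments that are weak rivals different from `x` number `U'`. -/
def Feasible (t : Preference m) (V : Profile m n) (M : Finset (Fin n)) (x y : Fin m)
    (l τ U U' : ℕ) : Prop :=
  (l = 0 → τ = 0) ∧ n ≤ 2 * (outCount V M y (l + 1) + τ) ∧
  (∀ d, d ≠ y → load t V M x y l τ d ≤ (n - 1) / 2) ∧
  (U ≤ (M.card - τ) * (weakRivals t y).card ∧ U' ≤ τ * ((weakRivals t y).erase x).card) ∧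
  Suffices (weakRivals t y) (fun d => (n - 1) / 2 - load t V M x y l τ d) (fun _ => M.card - τ)
    (fun d => if d = x then 0 else τ) (U - (M.card - τ)) (U' - τ) ∧
  Suffices (strongRivals t y) (fun d => (n - 1) / 2 - load t V M x y l τ d) (fun _ => M.card - τ)
    (fun d => if d = x then 0 else τ) ((M.card - τ) * (l + 1) - U) (τ * (l - 1) - U')

/-- The candidates on the top `s` positions. -/
def topSegment (p : Preference m) (s : ℕ) : Finset (Fin m) :=
  Finset.univ.filter fun d => (p.symm d : ℕ) < s

/-- The candidates that a vote `p` supports against `y`, if `y` is to win with a top segment of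
length `l + 1`. -/
def supported (t : Preference m) (y : Fin m) (l : ℕ) (p : Preference m) : Finset (Fin m) :=
  Finset.univ.filter fun d => (p.symm d : ℕ) < threshold t y l d

/-- The number of voters in `P` that support `d` against `y`. -/
def support (t : Preference m) (y : Fin m) (l : ℕ) (W : J → Preference m) (P : Finset J)
    (d : Fin m) : ℕ :=
  (P.filter fun j => d ∈ supported t y l (W j)).card

variable {t p : Preference m} {V W : Profile m n} {M Q P : Finset (Fin n)} {x y d : Fin m}
  {l τ U U' : ℕ} {S : Finset (Fin m)}

theorem mem_weakRivals : d ∈ weakRivals t y ↔ d ≠ y ∧ ¬ t.Prefers d y := by simp [weakRivals]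

theorem mem_strongRivals : d ∈ strongRivals t y ↔ t.Prefers d y := by simp [strongRivals]

theorem not_mem_strongRivals_self : y ∉ strongRivals t y := by
  simp [mem_strongRivals, not_prefers_self]

theorem univ_erase_sdiff_weakRivals : Finset.univ.erase y \ weakRivals t y = strongRivals t y := by
  ext d
  simp only [Finset.mem_sdiff, Finset.mem_erase, Finset.mem_univ, and_true, mem_weakRivals,
    mem_strongRivals, not_and, not_not]
  refine ⟨fun h => h.2 h.1, fun h => ⟨?_, fun _ => h⟩⟩
  rintro rfl
  exact not_prefers_self t d h

theorem weakRivals_subset : weakRivals t y ⊆ Finset.univ.erase y := fun d hd => by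
  simpa using (mem_weakRivals.1 hd).1

theorem card_inter_weakRivals_add_card_inter_strongRivals (hy : y ∉ S) :
    (S ∩ weakRivals t y).card + (S ∩ strongRivals t y).card = S.card := by
  have hS : S ⊆ Finset.univ.erase y := fun d hd => by simpa using ne_of_mem_of_not_mem hd hy
  rw [← univ_erase_sdiff_weakRivals, ← Finset.inter_sdiff_assoc, Finset.inter_eq_left.2 hS,
    Finset.card_inter_add_card_sdiff]

theorem mem_topSegment {s : ℕ} : d ∈ topSegment p s ↔ (p.symm d : ℕ) < s := by simp [topSegment]

theorem mem_supported : d ∈ supported t y l p ↔ (p.symm d : ℕ) < threshold t y l d := by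
  simp [supported]

theorem card_topSegment {s : ℕ} (hs : s ≤ m) : (topSegment p s).card = s := by
  have htop : topSegment p s =
      (Finset.univ.filter fun i : Fin m => (i : ℕ) < s).map p.toEmbedding := by
    ext d
    simp [topSegment, Finset.mem_map_equiv]
  rw [htop, Finset.card_map, Fin.card_filter_val_lt, min_eq_right hs]

theorem topCount_piecewise_threshold :
    topCount (M.piecewise W V) d (threshold t y l d) =
      outCount V M d (threshold t y l d) + support t y l W M d := by
  simp only [topCount_piecewise, support, mem_supported]

theorem support_sdiff_add_support [DecidableEq J] {W : J → Preference m} {M Q : Finset J}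
    (hQM : Q ⊆ M) (d : Fin m) :
    support t y l W (M \ Q) d + support t y l W Q d = support t y l W M d := by
  simp only [support, Finset.card_filter]
  exact Finset.sum_sdiff hQM

theorem support_le_card {W : J → Preference m} {P : Finset J} : support t y l W P d ≤ P.card :=
  Finset.card_filter_le _ _

theorem sum_support (W : J → Preference m) (P : Finset J) :
    ∑ d ∈ S, support t y l W P d = ∑ j ∈ P, (supported t y l (W j) ∩ S).card := by
  rw [sum_card_eq_sum_degree P _ fun _ _ => Finset.inter_subset_right]
  exact Finset.sum_congr rfl fun d hd => by simp [support, hd]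

/-! Necessity of the criterion: count the members of the top segments of the manipulators. -/

theorem card_topSegment_inter_le_of_subset_weakRivals (hl : l < m) (hS : S ⊆ weakRivals t y) :
    (topSegment p (l + 1) ∩ S).card ≤ (supported t y l p ∩ S).card + 1 := by
  have hsub : topSegment p (l + 1) ∩ S ⊆ insert (p ⟨l, hl⟩) (supported t y l p ∩ S) := by
    intro d hd
    rw [Finset.mem_inter, mem_topSegment] at hd
    rw [Finset.mem_insert, Finset.mem_inter, mem_supported, ← Equiv.symm_apply_eq, Fin.ext_iff,
      threshold, if_neg (mem_weakRivals.1 (hS hd.2)).2]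
    exact (Nat.lt_succ_iff_lt_or_eq.1 hd.1).symm.imp id fun h => ⟨h, hd.2⟩
  exact (Finset.card_le_card hsub).trans (Finset.card_insert_le _ _)

theorem topSegment_inter_eq_of_subset_strongRivals (hS : S ⊆ strongRivals t y) :
    topSegment p (l + 1) ∩ S = supported t y l p ∩ S := by
  ext d
  simp only [Finset.mem_inter, mem_topSegment, mem_supported]
  exact and_congr_left fun hd => by rw [threshold, if_pos (mem_strongRivals.1 (hS hd))]

theorem sum_card_topSegment_inter_sub_le (hl : l < m) (hS : S ⊆ weakRivals t y)
    (W : J → Preference m) (P : Finset J) :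
    ∑ j ∈ P, (topSegment (W j) (l + 1) ∩ S).card - P.card ≤ ∑ d ∈ S, support t y l W P d := by
  have hle := Finset.sum_le_sum fun j (_ : j ∈ P) =>
    card_topSegment_inter_le_of_subset_weakRivals (p := W j) hl hS
  rw [Finset.sum_add_distrib, Finset.sum_const, smul_eq_mul, mul_one] at hle
  rw [sum_support]
  omega

theorem sum_card_topSegment_inter_eq (hS : S ⊆ strongRivals t y) (W : J → Preference m)
    (P : Finset J) :
    ∑ j ∈ P, (topSegment (W j) (l + 1) ∩ S).card = ∑ d ∈ S, support t y l W P d := by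
  simp only [sum_support, topSegment_inter_eq_of_subset_strongRivals hS]

theorem card_topSegment_inter_rivals (hl : l < m) (hy : y ∉ topSegment p (l + 1)) :
    (topSegment p (l + 1) ∩ weakRivals t y).card +
      (topSegment p (l + 1) ∩ strongRivals t y).card = l + 1 := by
  rw [card_inter_weakRivals_add_card_inter_strongRivals hy, card_topSegment hl]

theorem sum_card_topSegment_inter_rivals (hl : l < m) {W : J → Preference m} {P : Finset J}
    (hy : ∀ j ∈ P, y ∉ topSegment (W j) (l + 1)) :
    ∑ j ∈ P, (topSegment (W j) (l + 1) ∩ weakRivals t y).card +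
      ∑ j ∈ P, (topSegment (W j) (l + 1) ∩ strongRivals t y).card = P.card * (l + 1) := by
  rw [← Finset.sum_add_distrib]
  exact Finset.sum_const_nat fun j hj => card_topSegment_inter_rivals hl (hy j hj)

theorem card_topSegment_inter_erase_rivals (hl : l < m) (hxy : x ≠ y)
    (hx : x ∈ topSegment p (l + 1)) (hy : y ∈ topSegment p (l + 1)) :
    (topSegment p (l + 1) ∩ (weakRivals t y).erase x).card +
      (topSegment p (l + 1) ∩ (strongRivals t y).erase x).card = l - 1 := by
  have hinter : ∀ S : Finset (Fin m), y ∉ S → topSegment p (l + 1) ∩ S.erase x =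
      ((topSegment p (l + 1)).erase x).erase y ∩ S := fun S hS => by
    ext d
    have : d ∈ S → d ≠ y := fun hd => ne_of_mem_of_not_mem hd hS
    simp only [Finset.mem_inter, Finset.mem_erase]
    tauto
  rw [hinter _ (by simp [mem_weakRivals]), hinter _ not_mem_strongRivals_self,
    card_inter_weakRivals_add_card_inter_strongRivals (Finset.notMem_erase _ _),
    Finset.card_erase_of_mem (Finset.mem_erase.2 ⟨hxy.symm, hy⟩), Finset.card_erase_of_mem hx,
    card_topSegment hl]
  omega

theorem sum_card_topSegment_inter_erase_rivals (hl : l < m) (hxy : x ≠ y) {W : J → Preference m}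
    {P : Finset J} (hx : ∀ j ∈ P, x ∈ topSegment (W j) (l + 1))
    (hy : ∀ j ∈ P, y ∈ topSegment (W j) (l + 1)) :
    ∑ j ∈ P, (topSegment (W j) (l + 1) ∩ (weakRivals t y).erase x).card +
      ∑ j ∈ P, (topSegment (W j) (l + 1) ∩ (strongRivals t y).erase x).card =
        P.card * (l - 1) := by
  rw [← Finset.sum_add_distrib]
  exact Finset.sum_const_nat fun j hj =>
    card_topSegment_inter_erase_rivals hl hxy (hx j hj) (hy j hj)

theorem support_add_load_le (hQM : Q ⊆ M) (hx : ∀ j ∈ Q, x ∈ supported t y l (W j))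
    (hd : 2 * topCount (M.piecewise W V) d (threshold t y l d) < n) :
    support t y l W (M \ Q) d + (if d = x then 0 else support t y l W Q d) +
      load t V M x y l Q.card d ≤ (n - 1) / 2 := by
  rw [topCount_piecewise_threshold, ← support_sdiff_add_support hQM] at hd
  unfold load
  split_ifs with h
  · subst h
    have : support t y l W Q d = Q.card := by
      rw [support, Finset.filter_true_of_mem hx]
    omega
  · omega

theorem suffices_of_win (hQM : Q ⊆ M) (hx : ∀ j ∈ Q, x ∈ supported t y l (W j))
    (hwin : ∀ d, d ≠ y → 2 * topCount (M.piecewise W V) d (threshold t y l d) < n) (hyS : y ∉ S)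
    {u v : ℕ} (hu : u ≤ ∑ d ∈ S, support t y l W (M \ Q) d)
    (hv : v ≤ ∑ d ∈ S.erase x, support t y l W Q d) :
    Suffices S (fun d => (n - 1) / 2 - load t V M x y l Q.card d) (fun _ => M.card - Q.card)
      (fun d => if d = x then 0 else Q.card) u v := by
  rw [← Finset.card_sdiff_of_subset hQM]
  refine .of_exists (u := support t y l W (M \ Q))
    (v := fun d => if d = x then 0 else support t y l W Q d) (fun d hdS => ⟨support_le_card, ?_,
      ?_⟩) hu (hv.trans ?_)
  · split_ifs
    · exact le_rfl
    · exact support_le_card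
  · have := support_add_load_le hQM hx (hwin d (ne_of_mem_of_not_mem hdS hyS))
    omega
  · rw [← Finset.sum_erase S (f := fun d => if d = x then 0 else _) (if_pos rfl)]
    exact (Finset.sum_congr rfl fun d hd => (if_neg (Finset.ne_of_mem_erase hd)).symm).le

theorem exists_feasible [NeZero m] (hn : 0 < n) (hxy : x ≠ y) (hW : ∀ j ∈ M, (W j).Prefers x y)
    (hwin : bucklin m n t (M.piecewise W V) = y) :
    ∃ l < m, ∃ τ ≤ M.card, ∃ U ≤ (M.card - τ) * (l + 1), ∃ U' ≤ τ * (l - 1),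
      Feasible t V M x y l τ U U' := by
  obtain ⟨l, hl, hy, hd⟩ := (bucklin_eq_iff_threshold hn t _ y).1 hwin
  rw [topCount_piecewise] at hy
  let Q := M.filter fun j => ((W j).symm y : ℕ) < l + 1
  have hQM : Q ⊆ M := Finset.filter_subset _ _
  have hyQ : ∀ j ∈ Q, y ∈ topSegment (W j) (l + 1) := fun j hj =>
    mem_topSegment.2 (Finset.mem_filter.1 hj).2
  have hyP : ∀ j ∈ M \ Q, y ∉ topSegment (W j) (l + 1) := fun j hj hyT =>
    (Finset.mem_sdiff.1 hj).2
      (Finset.mem_filter.2 ⟨(Finset.mem_sdiff.1 hj).1, mem_topSegment.1 hyT⟩)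
  have hxQ : ∀ j ∈ Q, ((W j).symm x : ℕ) < l := fun j hj =>
    (Fin.lt_def.1 (hW j (hQM hj))).trans_le (Nat.lt_succ_iff.1 (mem_topSegment.1 (hyQ j hj)))
  have hxsupp : ∀ j ∈ Q, x ∈ supported t y l (W j) := fun j hj => mem_supported.2 <| by
    have := hxQ j hj
    unfold threshold
    split_ifs <;> omega
  have hsumP := sum_card_topSegment_inter_rivals (t := t) hl hyP
  have hsumQ := sum_card_topSegment_inter_erase_rivals (t := t) hl hxy
    (fun j hj => mem_topSegment.2 ((hxQ j hj).trans (Nat.lt_succ_self l))) hyQ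
  have hle : ∀ (P : Finset (Fin n)) (S : Finset (Fin m)),
      ∑ j ∈ P, (topSegment (W j) (l + 1) ∩ S).card ≤ P.card * S.card := fun P S =>
    Finset.sum_le_card_nsmul _ _ _ fun j _ => Finset.card_le_card Finset.inter_subset_right
  have hweak := suffices_of_win (S := weakRivals t y) hQM hxsupp hd (by simp [mem_weakRivals])
    (sum_card_topSegment_inter_sub_le hl subset_rfl _ _)
    (sum_card_topSegment_inter_sub_le hl (Finset.erase_subset _ _) _ _)
  have hstrong := suffices_of_win (S := strongRivals t y) hQM hxsupp hd not_mem_strongRivals_self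
    (Nat.sub_eq_of_eq_add' hsumP.symm |>.trans (sum_card_topSegment_inter_eq subset_rfl _ _)).le
    (Nat.sub_eq_of_eq_add' hsumQ.symm |>.trans
      (sum_card_topSegment_inter_eq (Finset.erase_subset _ _) _ _)).le
  have hcard := Finset.card_sdiff_of_subset hQM
  simp only [hcard] at hweak hstrong hsumP
  refine ⟨l, hl, Q.card, Finset.card_le_card hQM, _, Nat.le.intro hsumP, _, Nat.le.intro hsumQ,
    fun h => ?_, hy, fun d hdy => (Nat.le_add_left _ _).trans
      (support_add_load_le hQM hxsupp (hd d hdy)), ⟨hcard ▸ hle _ _, hle _ _⟩, hweak, hstrong⟩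
  rw [Finset.card_eq_zero, Finset.eq_empty_iff_forall_notMem]
  exact fun j hj => by have := hxQ j hj; omega

/-! Sufficiency of the criterion: deal the candidates to the top segments of the manipulators. -/

theorem support_le_of_confined {W : J → Preference m} {P : Finset J} {A T : J → Finset (Fin m)}
    {k : ℕ} (hdy : d ≠ y)
    (hW : ∀ j ∈ P, (((W j).symm d : ℕ) < l → d ∈ A j) ∧ (((W j).symm d : ℕ) < l + 1 → d ∈ T j))
    (hA : d ∈ weakRivals t y → (P.filter fun j => d ∈ A j).card ≤ k)
    (hT : d ∈ strongRivals t y → (P.filter fun j => d ∈ T j).card ≤ k) :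
    support t y l W P d ≤ k := by
  have hcard : ∀ p q : J → Prop, ∀ [DecidablePred p] [DecidablePred q], (∀ j ∈ P, p j → q j) →
      (P.filter p).card ≤ (P.filter q).card := fun p q _ _ hpq =>
    Finset.card_le_card fun j hj => by
      rw [Finset.mem_filter] at hj ⊢
      exact ⟨hj.1, hpq j hj.1 hj.2⟩
  unfold support
  simp only [mem_supported]
  by_cases hs : t.Prefers d y
  · rw [threshold, if_pos hs]
    exact (hcard _ _ fun j hj => (hW j hj).2).trans
      (hT (mem_strongRivals.2 hs))
  · rw [threshold, if_neg hs]
    exact (hcard _ _ fun j hj => (hW j hj).1).trans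
      (hA (mem_weakRivals.2 ⟨hdy, hs⟩))

theorem exists_votes_bot (hxy : x ≠ y) (P : Finset J) (u : Fin m → ℕ)
    (hu : ∀ d, d ≠ y → u d ≤ P.card) (hU : U ≤ P.card * (l + 1))
    (hUW : U ≤ P.card * (weakRivals t y).card)
    (hweak : ∑ d ∈ weakRivals t y, u d = U - P.card)
    (hstrong : ∑ d ∈ strongRivals t y, u d = P.card * (l + 1) - U) :
    ∃ W : J → Preference m, (∀ j ∈ P, (W j).Prefers x y) ∧
      ∀ d, d ≠ y → support t y l W P d ≤ u d := by
  rw [← univ_erase_sdiff_weakRivals] at hstrong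
  obtain ⟨A, T, hAT, hA, hT⟩ := exists_deal P weakRivals_subset u (l + 1) U
    (fun d hd => hu d (Finset.ne_of_mem_erase hd)) hU hUW hweak hstrong
  rw [univ_erase_sdiff_weakRivals] at hT
  have hvote : ∀ j, ∃ p : Preference m, j ∈ P → p.Prefers x y ∧ ∀ d, d ≠ y →
      ((p.symm d : ℕ) < l → d ∈ A j) ∧ ((p.symm d : ℕ) < l + 1 → d ∈ T j) := fun j => by
    by_cases hj : j ∈ P
    · obtain ⟨hsub, hTy, hAc, hTc⟩ := hAT j hj
      obtain ⟨p, hp⟩ := exists_vote_bot (l := l) hxy hsub (fun h => by simpa using hTy h)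
        (by omega) (by omega)
      exact ⟨p, fun _ => hp⟩
    · exact ⟨1, fun h => absurd h hj⟩
  choose W hW using hvote
  exact ⟨W, fun j hj => (hW j hj).1, fun d hdy =>
    support_le_of_confined hdy (fun j hj => (hW j hj).2 d hdy) (hA d) (hT d)⟩

theorem exists_votes_top (hxy : x ≠ y) (Q : Finset J) (v : Fin m → ℕ) (hl : l = 0 → Q.card = 0)
    (hv : ∀ d, d ≠ y → v d ≤ if d = x then 0 else Q.card) (hU : U ≤ Q.card * (l - 1))
    (hUW : U ≤ Q.card * ((weakRivals t y).erase x).card)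
    (hweak : ∑ d ∈ weakRivals t y, v d = U - Q.card)
    (hstrong : ∑ d ∈ strongRivals t y, v d = Q.card * (l - 1) - U) :
    ∃ W : J → Preference m, (∀ j ∈ Q, (W j).Prefers x y ∧ ((W j).symm y : ℕ) < l + 1) ∧
      ∀ d, d ≠ y → d ≠ x → support t y l W Q d ≤ v d := by
  have hvx : v x = 0 := by simpa using hv x hxy
  have hsdiff : (Finset.univ.erase y).erase x \ (weakRivals t y).erase x =
      (strongRivals t y).erase x := by
    rw [← univ_erase_sdiff_weakRivals]
    grind
  rw [← Finset.sum_erase _ hvx] at hweak hstrong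
  rw [← hsdiff] at hstrong
  obtain ⟨A, T, hAT, hA, hT⟩ := exists_deal Q (Finset.erase_subset_erase x weakRivals_subset) v
    (l - 1) U (fun d hd =>
      (hv d (Finset.ne_of_mem_erase (Finset.mem_of_mem_erase hd))).trans (by split_ifs <;> omega))
    hU hUW hweak hstrong
  rw [hsdiff] at hT
  have hvote : ∀ j, ∃ p : Preference m, j ∈ Q → (p.Prefers x y ∧ (p.symm y : ℕ) < l + 1) ∧
      ∀ d, d ≠ y → d ≠ x →
        ((p.symm d : ℕ) < l → d ∈ A j) ∧ ((p.symm d : ℕ) < l + 1 → d ∈ T j) := fun j => by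
    by_cases hj : j ∈ Q
    · have hQpos := Finset.card_pos.2 ⟨j, hj⟩
      obtain ⟨hsub, hTxy, hAc, hTc⟩ := hAT j hj
      obtain ⟨p, hpxy, hpy, hp⟩ := exists_vote_top (l := l) hxy hsub
        (fun h => by simpa using hTxy h) (fun h => by simpa using hTxy h) (by omega) (by omega)
        (by omega)
      exact ⟨p, fun _ => ⟨⟨hpxy, hpy⟩, hp⟩⟩
    · exact ⟨1, fun h => absurd h hj⟩
  choose W hW using hvote
  exact ⟨W, fun j hj => (hW j hj).1, fun d hdy hdx =>
    support_le_of_confined hdy (fun j hj => (hW j hj).2 d hdy hdx)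
      (fun hd => hA d (Finset.mem_erase.2 ⟨hdx, hd⟩))
      (fun hd => hT d (Finset.mem_erase.2 ⟨hdx, hd⟩))⟩

theorem exists_rival_split {c p q : Fin m → ℕ} {U₁ V₁ U₂ V₂ : ℕ}
    (hweak : Suffices (weakRivals t y) c p q U₁ V₁)
    (hstrong : Suffices (strongRivals t y) c p q U₂ V₂) :
    ∃ u v : Fin m → ℕ, (∀ d, d ≠ y → u d ≤ p d ∧ v d ≤ q d ∧ u d + v d ≤ c d) ∧
      (∑ d ∈ weakRivals t y, u d = U₁ ∧ ∑ d ∈ weakRivals t y, v d = V₁) ∧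
      ∑ d ∈ strongRivals t y, u d = U₂ ∧ ∑ d ∈ strongRivals t y, v d = V₂ := by
  obtain ⟨u₁, v₁, h₁, hu₁, hv₁⟩ := hweak.exists_split
  obtain ⟨u₂, v₂, h₂, hu₂, hv₂⟩ := hstrong.exists_split
  have hsum_weak : ∀ f g : Fin m → ℕ,
      ∑ d ∈ weakRivals t y, (if t.Prefers d y then f d else g d) = ∑ d ∈ weakRivals t y, g d :=
    fun f g => Finset.sum_congr rfl fun d hd => if_neg (mem_weakRivals.1 hd).2
  have hsum_strong : ∀ f g : Fin m → ℕ,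
      ∑ d ∈ strongRivals t y, (if t.Prefers d y then f d else g d) =
        ∑ d ∈ strongRivals t y, f d :=
    fun f g => Finset.sum_congr rfl fun d hd => if_pos (mem_strongRivals.1 hd)
  refine ⟨fun d => if t.Prefers d y then u₂ d else u₁ d,
    fun d => if t.Prefers d y then v₂ d else v₁ d, fun d hdy => ?_,
    ⟨(hsum_weak _ _).trans hu₁, (hsum_weak _ _).trans hv₁⟩,
    (hsum_strong _ _).trans hu₂, (hsum_strong _ _).trans hv₂⟩
  dsimp only
  split_ifs with hd
  · exact h₂ d (mem_strongRivals.2 hd)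
  · exact h₁ d (mem_weakRivals.2 ⟨hdy, hd⟩)

theorem support_congr {W W' : J → Preference m} {P : Finset J} (h : ∀ j ∈ P, W j = W' j) :
    support t y l W P d = support t y l W' P d :=
  congrArg Finset.card (Finset.filter_congr fun j hj => by rw [h j hj])

theorem exists_manipulation [NeZero m] (hn : 0 < n) (hxy : x ≠ y) (hl : l < m) (hτ : τ ≤ M.card)
    (hU : U ≤ (M.card - τ) * (l + 1)) (hU' : U' ≤ τ * (l - 1))
    (h : Feasible t V M x y l τ U U') :
    ∃ W : Profile m n, (∀ j ∈ M, (W j).Prefers x y) ∧ bucklin m n t (M.piecewise W V) = y := by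
  obtain ⟨hl0, hy, hload, ⟨hUW, hUW'⟩, hweak, hstrong⟩ := h
  obtain ⟨Q, hQM, rfl⟩ := Finset.exists_subset_card_eq hτ
  obtain ⟨u, v, huv, ⟨huw, hvw⟩, hus, hvs⟩ := exists_rival_split hweak hstrong
  simp only [← Finset.card_sdiff_of_subset hQM] at huv huw hus hU hUW
  obtain ⟨W₁, hW₁, hu⟩ := exists_votes_bot hxy (M \ Q) u (fun d hd => (huv d hd).1) hU hUW huw hus
  obtain ⟨W₂, hW₂, hv⟩ := exists_votes_top hxy Q v hl0 (fun d hd => (huv d hd).2.1) hU' hUW' hvw hvs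
  let W := Q.piecewise W₂ W₁
  have hWP : ∀ j ∈ M \ Q, W j = W₁ j := fun j hj =>
    Finset.piecewise_eq_of_notMem _ _ _ (Finset.mem_sdiff.1 hj).2
  have hWQ : ∀ j ∈ Q, W j = W₂ j := fun j hj => Finset.piecewise_eq_of_mem _ _ _ hj
  refine ⟨W, fun j hj => ?_, (bucklin_eq_iff_threshold hn t _ y).2 ⟨l, hl, ?_, fun d hdy => ?_⟩⟩
  · by_cases hjQ : j ∈ Q
    · exact hWQ j hjQ ▸ (hW₂ j hjQ).1
    · have hjP := Finset.mem_sdiff.2 ⟨hj, hjQ⟩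
      exact hWP j hjP ▸ hW₁ j hjP
  · have hQy : Q.card ≤ (M.filter fun j => ((W j).symm y : ℕ) < l + 1).card :=
      Finset.card_le_card fun j hj =>
        Finset.mem_filter.2 ⟨hQM hj, by rw [hWQ j hj]; exact (hW₂ j hj).2⟩
    rw [topCount_piecewise]
    omega
  · have hPd : support t y l W (M \ Q) d ≤ u d := (support_congr hWP).trans_le (hu d hdy)
    have hQd : support t y l W Q d ≤ v d + if d = x then Q.card else 0 := by
      split_ifs with hdx
      · exact support_le_card.trans (Nat.le_add_left _ _)
      · exact (support_congr hWQ).trans_le (hv d hdy hdx)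
    have huvd := (huv d hdy).2.2
    have hloadd := hload d hdy
    rw [topCount_piecewise_threshold, ← support_sdiff_add_support hQM]
    unfold load at huvd hloadd
    omega

theorem exists_manipulation_iff [NeZero m] (hn : 0 < n) (hxy : x ≠ y) :
    (∃ W : Profile m n, (∀ j ∈ M, (W j).Prefers x y) ∧ bucklin m n t (M.piecewise W V) = y) ↔
      ∃ l < m, ∃ τ ≤ M.card, ∃ U ≤ (M.card - τ) * (l + 1), ∃ U' ≤ τ * (l - 1),
        Feasible t V M x y l τ U U' :=
  ⟨fun ⟨_, hW, h⟩ => exists_feasible hn hxy hW h,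
    fun ⟨_, hl, _, hτ, _, hU, _, hU', h⟩ => exists_manipulation hn hxy hl hτ hU hU' h⟩

end Criterion

/-! ### Definability of the criterion on encoded elections -/

open Classical in
/-- The number of occurrences of the symbol `1` after exactly `k` commas. -/
noncomputable def onesAt (w : List Γ') (k : ℕ) : ℕ :=
  ((Finset.range w.length).filter fun p => w[p]? = some (Γ'.bit true) ∧
    ((Finset.range p).filter fun q => w[q]? = some Γ'.comma).card = k).card

/-- The candidate at position `j` of the preference `b` in the word `w`, in which every preference
lists `m` candidates in unary, each followed by a comma. The preference `0` is the tie-breaking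
preference, and the preference `i + 1` is the vote of the voter `i`. -/
noncomputable def entryAt (w : List Γ') (m b j : ℕ) : ℕ :=
  onesAt w (m * b + j)

/-- The first preference of the word ranks `d` above `y`. -/
def Above (w : List Γ') (m d y : ℕ) : Prop :=
  ∃ j < m, entryAt w m 0 j = y ∧ ∃ j' < j, entryAt w m 0 j' = d

open Classical in
/-- The number of voters outside of `mem` that rank `d` in their top `l` positions. -/
noncomputable def countOut (w : List Γ') (m n : ℕ) (mem : ℕ → Prop) (d l : ℕ) : ℕ :=
  ((Finset.range n).filter fun i => ¬ mem i ∧ ∃ j < l, entryAt w m (i + 1) j = d).card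

/-- `x` wins the election. -/
def Wins (w : List Γ') (m n x : ℕ) : Prop :=
  ∃ l < m, n ≤ 2 * countOut w m n (fun _ => False) x (l + 1) ∧
    ∀ d < m, d ≠ x → 2 * countOut w m n (fun _ => False) d l < n ∧
      (Above w m d x → 2 * countOut w m n (fun _ => False) d (l + 1) < n)

open Classical in
/-- The numerical version of `load`. -/
noncomputable def loadAt (w : List Γ') (m n : ℕ) (mem : ℕ → Prop) (x y l τ d : ℕ) : ℕ :=
  countOut w m n mem d (if Above w m d y then l + 1 else l) + if d = x then τ else 0

open Classical in
/-- The numerical version of `Suffices`. -/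
def SufficesBelow (m : ℕ) (S : ℕ → Prop) (c : ℕ → ℕ) (p : ℕ) (q : ℕ → ℕ) (U V : ℕ) : Prop :=
  U ≤ ∑ d ∈ Finset.range m, (if S d then min (c d) p else 0) ∧
    V ≤ ∑ d ∈ Finset.range m, (if S d then min (c d) (q d) else 0) ∧
    U + V ≤ ∑ d ∈ Finset.range m, (if S d then min (c d) (p + q d) else 0)

open Classical in
/-- The numerical version of `Feasible`, for `k` manipulators. -/
def FeasibleAt (w : List Γ') (m n : ℕ) (mem : ℕ → Prop) (k x y l τ U U' : ℕ) : Prop :=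
  (l = 0 → τ = 0) ∧ n ≤ 2 * (countOut w m n mem y (l + 1) + τ) ∧
  (∀ d < m, d ≠ y → loadAt w m n mem x y l τ d ≤ (n - 1) / 2) ∧
  (U ≤ (k - τ) * ((Finset.range m).filter fun d => d ≠ y ∧ ¬ Above w m d y).card ∧
    U' ≤ τ * ((Finset.range m).filter fun d => d ≠ x ∧ d ≠ y ∧ ¬ Above w m d y).card) ∧
  SufficesBelow m (fun d => d ≠ y ∧ ¬ Above w m d y)
    (fun d => (n - 1) / 2 - loadAt w m n mem x y l τ d) (k - τ)
    (fun d => if d = x then 0 else τ) (U - (k - τ)) (U' - τ) ∧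
  SufficesBelow m (fun d => Above w m d y)
    (fun d => (n - 1) / 2 - loadAt w m n mem x y l τ d) (k - τ)
    (fun d => if d = x then 0 else τ) ((k - τ) * (l + 1) - U) (τ * (l - 1) - U')

open Classical in
/-- The set `mem` is a coalition of possible manipulators against `y`. -/
def CoalitionAt (w : List Γ') (m n y : ℕ) (mem : ℕ → Prop) : Prop :=
  ∃ x < m, x ≠ y ∧ Wins w m n x ∧ ∃ l < m, ∃ τ ≤ ((Finset.range n).filter mem).card,
    ∃ U ≤ (((Finset.range n).filter mem).card - τ) * (l + 1), ∃ U' ≤ τ * (l - 1),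
      FeasibleAt w m n mem ((Finset.range n).filter mem).card x y l τ U U'

/-- Some coalition arising from `mem` by adding at most `k` voters can manipulate. -/
def ExtensionAt (w : List Γ') (m n y : ℕ) : ℕ → (ℕ → Prop) → Prop
  | 0, mem => CoalitionAt w m n y mem
  | k + 1, mem => ExtensionAt w m n y k mem ∨ ∃ i < n, ExtensionAt w m n y k fun j => mem j ∨ j = i

/-- The word describes the tie-breaking preference `t` and the profile `V`. -/
def Describes {m n : ℕ} (w : List Γ') (t : Preference m) (V : Profile m n) : Prop :=
  (∀ j : Fin m, entryAt w m 0 j = t j) ∧ ∀ (i : Fin n) (j : Fin m), entryAt w m (i + 1) j = V i j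

section Describes

variable {m n : ℕ}

theorem exists_lt_eq_iff {p : Preference m} {f : ℕ → ℕ} (h : ∀ j : Fin m, f j = p j) {l : ℕ}
    (hl : l ≤ m) (d : Fin m) : (∃ j < l, f j = d) ↔ (p.symm d : ℕ) < l := by
  constructor
  · rintro ⟨j, hj, hd⟩
    have hpj : p ⟨j, hj.trans_le hl⟩ = d := Fin.ext ((h ⟨j, hj.trans_le hl⟩).symm.trans hd)
    rwa [← hpj, Equiv.symm_apply_apply]
  · exact fun hd => ⟨p.symm d, hd, by rw [h, Equiv.apply_symm_apply]⟩

theorem forall_lt_iff {p : ℕ → Prop} : (∀ d < m, p d) ↔ ∀ d : Fin m, p d :=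
  ⟨fun h d => h d d.2, fun h d hd => h ⟨d, hd⟩⟩

theorem exists_lt_iff {p : ℕ → Prop} : (∃ d < m, p d) ↔ ∃ d : Fin m, p d :=
  ⟨fun ⟨d, hd, h⟩ => ⟨⟨d, hd⟩, h⟩, fun ⟨d, h⟩ => ⟨d, d.2, h⟩⟩

theorem card_filter_range {S : ℕ → Prop} [DecidablePred S] (S' : Finset (Fin m))
    (hS : ∀ d : Fin m, S d ↔ d ∈ S') : ((Finset.range m).filter S).card = S'.card := by
  rw [Finset.card_filter, Finset.sum_range, Finset.card_eq_sum_ones]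
  simp only [hS, Finset.sum_ite_mem, Finset.univ_inter]

theorem sum_range_ite {S : ℕ → Prop} [DecidablePred S] {f : ℕ → ℕ} {S' : Finset (Fin m)}
    {f' : Fin m → ℕ} (hS : ∀ d : Fin m, S d ↔ d ∈ S') (hf : ∀ d : Fin m, f d = f' d) :
    ∑ d ∈ Finset.range m, (if S d then f d else 0) = ∑ d ∈ S', f' d := by
  rw [Finset.sum_range]
  simp only [hS, hf, Finset.sum_ite_mem, Finset.univ_inter]

theorem sufficesBelow_iff {S : ℕ → Prop} {S' : Finset (Fin m)} {c q : ℕ → ℕ} {c' q' : Fin m → ℕ}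
    (hS : ∀ d : Fin m, S d ↔ d ∈ S') (hc : ∀ d : Fin m, c d = c' d) (p : ℕ)
    (hq : ∀ d : Fin m, q d = q' d) (U V : ℕ) :
    SufficesBelow m S c p q U V ↔ Suffices S' c' (fun _ => p) q' U V := by
  classical
  unfold SufficesBelow Suffices
  rw [sum_range_ite (f' := fun d => min (c' d) p) hS fun d => by rw [hc],
    sum_range_ite (f' := fun d => min (c' d) (q' d)) hS fun d => by rw [hc, hq],
    sum_range_ite (f' := fun d => min (c' d) (p + q' d)) hS fun d => by rw [hc, hq]]

namespace Describes

variable {w : List Γ'} {t : Preference m} {V : Profile m n} {mem : ℕ → Prop} {M : Finset (Fin n)}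

theorem above_iff (h : Describes w t V) (d y : Fin m) : Above w m d y ↔ t.Prefers d y := by
  constructor
  · rintro ⟨j, hj, hy, hd⟩
    rw [exists_lt_eq_iff h.1 hj.le] at hd
    have htj : t ⟨j, hj⟩ = y := Fin.ext ((h.1 ⟨j, hj⟩).symm.trans hy)
    rw [← Equiv.eq_symm_apply] at htj
    rwa [Preference.Prefers, ← htj]
  · exact fun hd => ⟨t.symm y, (t.symm y).2, by rw [h.1, Equiv.apply_symm_apply],
      (exists_lt_eq_iff h.1 (t.symm y).2.le d).2 hd⟩

theorem countOut_eq (h : Describes w t V) (hM : ∀ i : Fin n, mem i ↔ i ∈ M) (d : Fin m) {l : ℕ}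
    (hl : l ≤ m) : countOut w m n mem d l = outCount V M d l := by
  classical
  refine card_filter_range _ fun i => ?_
  rw [exists_lt_eq_iff (h.2 i) hl, hM, Finset.mem_filter_univ]

theorem countOut_eq_topCount (h : Describes w t V) (d : Fin m) {l : ℕ} (hl : l ≤ m) :
    countOut w m n (fun _ => False) d l = topCount V d l := by
  rw [h.countOut_eq (M := ∅) (by simp) d hl]
  simp [outCount, topCount]

theorem wins_iff [NeZero m] (hn : 0 < n) (h : Describes w t V) (x : Fin m) :
    Wins w m n x ↔ bucklin m n t V = x := by
  rw [bucklin_eq_iff hn]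
  refine exists_congr fun l => and_congr_right fun hl => ?_
  rw [h.countOut_eq_topCount x hl, forall_lt_iff]
  refine and_congr_right fun _ => forall_congr' fun d => ?_
  rw [h.countOut_eq_topCount d hl, h.countOut_eq_topCount d hl.le, h.above_iff, Ne, Fin.val_inj]

theorem loadAt_eq (h : Describes w t V) (hM : ∀ i : Fin n, mem i ↔ i ∈ M) (x y : Fin m) {l : ℕ}
    (hl : l < m) (τ : ℕ) (d : Fin m) :
    loadAt w m n mem x y l τ d = load t V M x y l τ d := by
  unfold loadAt load threshold
  simp only [h.above_iff, Fin.val_inj]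
  rw [h.countOut_eq hM]
  split_ifs <;> omega

theorem feasibleAt_iff (h : Describes w t V) (hM : ∀ i : Fin n, mem i ↔ i ∈ M) (x y : Fin m)
    {l : ℕ} (hl : l < m) (τ U U' : ℕ) :
    FeasibleAt w m n mem M.card x y l τ U U' ↔ Feasible t V M x y l τ U U' := by
  classical
  have hload := h.loadAt_eq hM x y hl τ
  have hweak : ∀ d : Fin m, ((d : ℕ) ≠ y ∧ ¬ Above w m d y) ↔ d ∈ weakRivals t y := fun d => by
    rw [mem_weakRivals, h.above_iff, Ne, Fin.val_inj]
  have hweak_erase : ∀ d : Fin m, ((d : ℕ) ≠ x ∧ (d : ℕ) ≠ y ∧ ¬ Above w m d y) ↔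
      d ∈ (weakRivals t y).erase x := fun d => by
    rw [hweak, Finset.mem_erase, Ne, Fin.val_inj]
  have hstrong : ∀ d : Fin m, Above w m d y ↔ d ∈ strongRivals t y := fun d => by
    rw [mem_strongRivals, h.above_iff]
  have hcapacity : ∀ d : Fin m, (n - 1) / 2 - loadAt w m n mem x y l τ d =
      (n - 1) / 2 - load t V M x y l τ d := fun d => by rw [hload]
  have hτ : ∀ d : Fin m, (if (d : ℕ) = x then 0 else τ) = if d = x then 0 else τ := fun d => by
    simp only [Fin.val_inj]
  unfold FeasibleAt Feasible
  rw [h.countOut_eq hM y hl, forall_lt_iff, card_filter_range _ hweak,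
    card_filter_range _ hweak_erase, sufficesBelow_iff hweak hcapacity _ hτ,
    sufficesBelow_iff hstrong hcapacity _ hτ]
  simp only [hload, Ne, Fin.val_inj]

theorem coalitionAt_iff [NeZero m] (hn : 0 < n) (h : Describes w t V)
    (hM : ∀ i : Fin n, mem i ↔ i ∈ M) (y : Fin m) :
    CoalitionAt w m n y mem ↔ IsPossibleCoalitionAgainst (bucklin m n t) V M y := by
  classical
  unfold CoalitionAt IsPossibleCoalitionAgainst
  simp only [card_filter_range M hM]
  rw [exists_lt_iff]
  constructor
  · rintro ⟨x, hxy, hx, l, hl, τ, hτ, U, hU, U', hU', hf⟩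
    rw [h.wins_iff hn] at hx
    subst hx
    have hne : bucklin m n t V ≠ y := fun e => hxy (by rw [e])
    exact ⟨hne.symm, (exists_manipulation_iff hn hne).2
      ⟨l, hl, τ, hτ, U, hU, U', hU', (h.feasibleAt_iff hM _ y hl τ U U').1 hf⟩⟩
  · rintro ⟨hy, hW⟩
    obtain ⟨l, hl, τ, hτ, U, hU, U', hU', hf⟩ := (exists_manipulation_iff hn hy.symm).1 hW
    exact ⟨bucklin m n t V, fun e => hy (Fin.ext e.symm), (h.wins_iff hn _).2 rfl, l, hl, τ, hτ, U,
      hU, U', hU', (h.feasibleAt_iff hM _ y hl τ U U').2 hf⟩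

theorem extensionAt_iff [NeZero m] (hn : 0 < n) (h : Describes w t V) (y : Fin m) (k : ℕ)
    (hM : ∀ i : Fin n, mem i ↔ i ∈ M) :
    ExtensionAt w m n y k mem ↔ ∃ M' : Finset (Fin n), M'.card ≤ k ∧
      IsPossibleCoalitionAgainst (bucklin m n t) V (M ∪ M') y := by
  induction k generalizing mem M with
  | zero =>
    simp only [ExtensionAt, Nat.le_zero, Finset.card_eq_zero, exists_eq_left, Finset.union_empty]
    exact h.coalitionAt_iff hn hM y
  | succ k ih =>
    have hinsert : ∀ i : Fin n, ExtensionAt w m n y k (fun j => mem j ∨ j = i) ↔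
        ∃ M' : Finset (Fin n), M'.card ≤ k ∧
          IsPossibleCoalitionAgainst (bucklin m n t) V (insert i M ∪ M') y := fun i =>
      ih fun j => by rw [hM, Fin.val_inj, Finset.mem_insert, or_comm]
    rw [ExtensionAt, ih hM, exists_lt_iff]
    constructor
    · rintro (⟨M', hM', hc⟩ | ⟨i, hi⟩)
      · exact ⟨M', Nat.le_succ_of_le hM', hc⟩
      · obtain ⟨M', hM', hc⟩ := (hinsert i).1 hi
        exact ⟨insert i M', (Finset.card_insert_le _ _).trans (Nat.succ_le_succ hM'), by
          rwa [Finset.union_insert, ← Finset.insert_union]⟩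
    · rintro ⟨M', hM', hc⟩
      rcases M'.eq_empty_or_nonempty with rfl | ⟨i, hi⟩
      · exact .inl ⟨∅, Nat.zero_le k, hc⟩
      · refine .inr ⟨i, (hinsert i).2 ⟨M'.erase i, ?_, ?_⟩⟩
        · rwa [Finset.card_erase_of_mem hi, Nat.sub_le_iff_le_add]
        · rwa [Finset.insert_union, ← Finset.union_insert, Finset.insert_erase hi]

end Describes

end Describes

section Definability

variable {X : Type} [Context Γ' X] {m n k x y l τ U U' d b j : X → ℕ} {mem : X → ℕ → Prop}

theorem Definable.half {f : X → ℕ} (hf : Definable f) : Definable fun x => f x / 2 := by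
  have hcount : (fun x => f x / 2) = fun x =>
      ((Finset.range (f x)).filter fun i => 2 * (i + 1) ≤ f x).card := by
    funext x
    have hrange : ((Finset.range (f x)).filter fun i => 2 * (i + 1) ≤ f x) =
        Finset.range (f x / 2) := by
      ext i
      simp only [Finset.mem_filter, Finset.mem_range]
      omega
    rw [hrange, Finset.card_range]
  rw [hcount]
  exact .count hf (.le ((Definable.const 2).mul (Definable.snd.add .one)) hf.fst)

theorem DefinablePred.exists_le {p : X → ℕ → Prop} (hb : Definable b)
    (hp : DefinablePred fun c : X × ℕ => p c.1 c.2) : DefinablePred fun c => ∃ i ≤ b c, p c i :=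
  (exists_lt (hb.add .one) hp).congr fun c => by simp only [Nat.lt_succ_iff]

theorem Definable.onesAt (hk : Definable k) : Definable fun c => onesAt (Context.word c) (k c) :=
  .count .length_word ((DefinablePred.sym (X := X × ℕ) _ .snd).and
    (.eq (.count .snd (DefinablePred.sym (X := (X × ℕ) × ℕ) _ .snd)) hk.fst))

theorem Definable.entryAt (hm : Definable m) (hb : Definable b) (hj : Definable j) :
    Definable fun c => entryAt (Context.word c) (m c) (b c) (j c) :=
  .onesAt ((hm.mul hb).add hj)

theorem DefinablePred.above (hm : Definable m) (hd : Definable d) (hy : Definable y) :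
    DefinablePred fun c => Above (Context.word c) (m c) (d c) (y c) :=
  .exists_lt hm ((DefinablePred.eq (Definable.entryAt (X := X × ℕ) hm.fst (.const 0) .snd)
    hy.fst).and (.exists_lt .snd
      (.eq (Definable.entryAt (X := (X × ℕ) × ℕ) hm.fst.fst (.const 0) .snd) hd.fst.fst)))

theorem Definable.countOut (hm : Definable m) (hn : Definable n)
    (hmem : DefinablePred fun c : X × ℕ => mem c.1 c.2) (hd : Definable d) (hl : Definable l) :
    Definable fun c => countOut (Context.word c) (m c) (n c) (mem c) (d c) (l c) :=
  .count hn (hmem.not.and (.exists_lt hl.fst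
    (.eq (Definable.entryAt (X := (X × ℕ) × ℕ) hm.fst.fst (Definable.snd.fst.add .one) .snd)
      hd.fst.fst)))

theorem DefinablePred.wins (hm : Definable m) (hn : Definable n) (hx : Definable x) :
    DefinablePred fun c => Wins (Context.word c) (m c) (n c) (x c) := by
  have hsupport : Definable fun c : (X × ℕ) × ℕ =>
      countOut (Context.word c) (m c.1.1) (n c.1.1) (fun _ => False) c.2 c.1.2 :=
    .countOut hm.fst.fst hn.fst.fst (.const False) .snd Definable.snd.fst
  have hsupport_succ : Definable fun c : (X × ℕ) × ℕ =>
      countOut (Context.word c) (m c.1.1) (n c.1.1) (fun _ => False) c.2 (c.1.2 + 1) :=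
    .countOut hm.fst.fst hn.fst.fst (.const False) .snd (Definable.snd.fst.add .one)
  have hwinner : Definable fun c : X × ℕ =>
      countOut (Context.word c) (m c.1) (n c.1) (fun _ => False) (x c.1) (c.2 + 1) :=
    .countOut hm.fst hn.fst (.const False) hx.fst (Definable.snd.add .one)
  exact .exists_lt hm (.and (.le hn.fst (.mul (.const 2) hwinner)) (.forall_lt hm.fst
    (.imp (.ne .snd hx.fst.fst) (.and (.lt (.mul (.const 2) hsupport) hn.fst.fst)
      (.imp (DefinablePred.above (X := (X × ℕ) × ℕ) hm.fst.fst .snd hx.fst.fst)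
        (.lt (.mul (.const 2) hsupport_succ) hn.fst.fst))))))

theorem Definable.loadAt (hm : Definable m) (hn : Definable n)
    (hmem : DefinablePred fun c : X × ℕ => mem c.1 c.2) (hx : Definable x) (hy : Definable y)
    (hl : Definable l) (hτ : Definable τ) (hd : Definable d) :
    Definable fun c => loadAt (Context.word c) (m c) (n c) (mem c) (x c) (y c) (l c) (τ c) (d c) :=
  (Definable.countOut hm hn hmem hd (.ite (.above hm hd hy) (hl.add .one) hl)).add
    (.ite (.eq hd hx) hτ (.const 0))

theorem DefinablePred.sufficesBelow {S : X → ℕ → Prop} {f q : X → ℕ → ℕ} {p : X → ℕ}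
    (hm : Definable m) (hS : DefinablePred fun c : X × ℕ => S c.1 c.2)
    (hf : Definable fun c : X × ℕ => f c.1 c.2) (hp : Definable p)
    (hq : Definable fun c : X × ℕ => q c.1 c.2) (hU : Definable U) (hU' : Definable U') :
    DefinablePred fun c => SufficesBelow (m c) (S c) (f c) (p c) (q c) (U c) (U' c) :=
  (DefinablePred.le hU (.sum hm (.ite hS (hf.min hp.fst) (.const 0)))).and
    ((DefinablePred.le hU' (.sum hm (.ite hS (hf.min hq) (.const 0)))).and
      (.le (hU.add hU') (.sum hm (.ite hS (hf.min (hp.fst.add hq)) (.const 0)))))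

theorem DefinablePred.feasibleAt (hm : Definable m) (hn : Definable n)
    (hmem : DefinablePred fun c : X × ℕ => mem c.1 c.2) (hk : Definable k) (hx : Definable x)
    (hy : Definable y) (hl : Definable l) (hτ : Definable τ) (hU : Definable U)
    (hU' : Definable U') :
    DefinablePred fun c => FeasibleAt (Context.word c) (m c) (n c) (mem c) (k c) (x c) (y c) (l c)
      (τ c) (U c) (U' c) := by
  have hbound : Definable fun c => (n c - 1) / 2 := (hn.sub .one).half
  have hload : Definable fun c : X × ℕ => loadAt (Context.word c.1) (m c.1) (n c.1) (mem c.1)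
      (x c.1) (y c.1) (l c.1) (τ c.1) c.2 :=
    Definable.loadAt (X := X × ℕ) hm.fst hn.fst hmem.under hx.fst hy.fst hl.fst hτ.fst .snd
  have hstrong : DefinablePred fun c : X × ℕ => Above (Context.word c.1) (m c.1) c.2 (y c.1) :=
    DefinablePred.above (X := X × ℕ) hm.fst .snd hy.fst
  have hweak : DefinablePred fun c : X × ℕ =>
      c.2 ≠ y c.1 ∧ ¬ Above (Context.word c.1) (m c.1) c.2 (y c.1) :=
    (DefinablePred.ne .snd hy.fst).and hstrong.not
  have hcapacity := hbound.fst.sub hload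
  have hrest := hk.sub hτ
  have hq : Definable fun c : X × ℕ => if c.2 = x c.1 then 0 else τ c.1 :=
    .ite (.eq .snd hx.fst) (.const 0) hτ.fst
  exact .and (.imp (.eq hl (.const 0)) (.eq hτ (.const 0))) <|
    .and (.le hn (.mul (.const 2) (.add (.countOut hm hn hmem hy (hl.add .one)) hτ))) <|
    .and (.forall_lt hm (.imp (.ne .snd hy.fst) (.le hload hbound.fst))) <|
    .and (.and (.le hU (hrest.mul (.count hm hweak)))
      (.le hU' (hτ.mul (.count hm (.and (.ne .snd hx.fst) hweak))))) <|
    .and (.sufficesBelow hm hweak hcapacity hrest hq (hU.sub hrest) (hU'.sub hτ))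
      (.sufficesBelow hm hstrong hcapacity hrest hq ((hrest.mul (hl.add .one)).sub hU)
        ((hτ.mul (hl.sub .one)).sub hU'))

theorem DefinablePred.coalitionAt (hm : Definable m) (hn : Definable n) (hy : Definable y)
    (hmem : DefinablePred fun c : X × ℕ => mem c.1 c.2) :
    DefinablePred fun c => CoalitionAt (Context.word c) (m c) (n c) (y c) (mem c) := by
  classical
  have hk : Definable fun c => ((Finset.range (n c)).filter (mem c)).card := .count hn hmem
  have hmember : DefinablePred fun c : (((((X × ℕ) × ℕ) × ℕ) × ℕ) × ℕ) × ℕ =>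
      mem c.1.1.1.1.1.1 c.2 :=
    under (p := fun c : (((X × ℕ) × ℕ) × ℕ) × ℕ => mem c.1.1.1.1) <|
      under (p := fun c : ((X × ℕ) × ℕ) × ℕ => mem c.1.1.1) <|
      under (p := fun c : (X × ℕ) × ℕ => mem c.1.1) <|
      under (p := fun c : X × ℕ => mem c.1) hmem.under
  have hfeasible := feasibleAt (X := ((((X × ℕ) × ℕ) × ℕ) × ℕ) × ℕ)
    (mem := fun c => mem c.1.1.1.1.1) hm.fst.fst.fst.fst.fst hn.fst.fst.fst.fst.fst
    hmember hk.fst.fst.fst.fst.fst Definable.snd.fst.fst.fst.fst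
    hy.fst.fst.fst.fst.fst Definable.snd.fst.fst.fst Definable.snd.fst.fst Definable.snd.fst .snd
  refine .exists_lt hm (.and (.ne .snd hy.fst) (.and (wins (X := X × ℕ) hm.fst hn.fst .snd)
    (.exists_lt hm.fst (.exists_le ?_ (.exists_le ?_ (.exists_le ?_ ?_))))))
  · convert! hk.fst.fst
  · convert! (hk.fst.fst.fst.sub Definable.snd).mul (Definable.snd.fst.add .one)
  · exact Definable.snd.fst.mul (Definable.snd.fst.fst.sub .one)
  · convert! hfeasible

theorem DefinablePred.extensionAt (hm : Definable m) (hn : Definable n) (hy : Definable y)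
    (k : ℕ) (hmem : DefinablePred fun c : X × ℕ => mem c.1 c.2) :
    DefinablePred fun c => ExtensionAt (Context.word c) (m c) (n c) (y c) k (mem c) := by
  induction k generalizing X with
  | zero => exact coalitionAt hm hn hy hmem
  | succ k ih =>
    exact (ih hm hn hy hmem).or (.exists_lt hn (ih (X := X × ℕ)
      (mem := fun c j => mem c.1 j ∨ j = c.2) hm.fst hn.fst hy.fst
      (hmem.under.or (.eq .snd Definable.snd.fst))))

end Definability

section Decoding

theorem onesAt_comma_zero (w : List Γ') : onesAt (Γ'.comma :: w) 0 = 0 := by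
  classical
  refine Finset.card_eq_zero.2 (Finset.filter_eq_empty_iff.2 ?_)
  rintro (_ | p) - ⟨hbit, hcommas⟩
  · simp at hbit
  · exact (Finset.card_pos.2 ⟨0, by simp⟩).ne' hcommas

theorem onesAt_comma_succ (w : List Γ') (k : ℕ) : onesAt (Γ'.comma :: w) (k + 1) = onesAt w k := by
  classical
  simp only [onesAt, Finset.card_filter, List.length_cons, Finset.sum_range_succ',
    List.getElem?_cons_succ, List.getElem?_cons_zero]
  simp

theorem onesAt_cons {a : Γ'} (ha : a ≠ Γ'.comma) (w : List Γ') (k : ℕ) :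
    onesAt (a :: w) k = onesAt w k + if a = Γ'.bit true ∧ k = 0 then 1 else 0 := by
  classical
  simp only [onesAt, Finset.card_filter, List.length_cons, Finset.sum_range_succ',
    List.getElem?_cons_succ, List.getElem?_cons_zero]
  simp [ha, eq_comm (a := k)]

/-- A number in unary, followed by a comma: the encoding of the candidate with this index. -/
def encodeUnary (c : ℕ) : List Γ' := List.replicate c (Γ'.bit true) ++ [Γ'.comma]

theorem onesAt_encodeUnary_append_zero (c : ℕ) (w : List Γ') :
    onesAt (encodeUnary c ++ w) 0 = c := by
  induction c with
  | zero => exact onesAt_comma_zero w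
  | succ c ih =>
    change onesAt (Γ'.bit true :: (encodeUnary c ++ w)) 0 = c + 1
    rw [onesAt_cons (by simp), ih, if_pos ⟨rfl, rfl⟩]

theorem onesAt_encodeUnary_append_succ (c : ℕ) (w : List Γ') (k : ℕ) :
    onesAt (encodeUnary c ++ w) (k + 1) = onesAt w k := by
  induction c with
  | zero => exact onesAt_comma_succ w k
  | succ c ih =>
    change onesAt (Γ'.bit true :: (encodeUnary c ++ w)) (k + 1) = onesAt w k
    rw [onesAt_cons (by simp), ih, if_neg (fun h => k.succ_ne_zero h.2), add_zero]

theorem onesAt_flatMap_append_of_lt (l : List ℕ) (w : List Γ') {k : ℕ} (hk : k < l.length) :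
    onesAt (l.flatMap encodeUnary ++ w) k = l[k] := by
  induction l generalizing k with
  | nil => exact absurd hk k.not_lt_zero
  | cons c l ih =>
    rw [List.flatMap_cons, List.append_assoc]
    cases k with
    | zero => exact onesAt_encodeUnary_append_zero c _
    | succ k => exact (onesAt_encodeUnary_append_succ c _ k).trans (ih (Nat.lt_of_succ_lt_succ hk))

theorem onesAt_flatMap_append_add (l : List ℕ) (w : List Γ') (k : ℕ) :
    onesAt (l.flatMap encodeUnary ++ w) (l.length + k) = onesAt w k := by
  induction l with
  | nil => simp
  | cons c l ih =>
    rw [List.flatMap_cons, List.append_assoc, List.length_cons, Nat.add_right_comm,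
      onesAt_encodeUnary_append_succ, ih]

theorem encodePreference_append {m : ℕ} (p : Preference m) (w : List Γ') :
    encodePreference p ++ w =
      Γ'.bra :: ((List.ofFn fun j => (p j : ℕ)).flatMap encodeUnary ++ Γ'.ket :: w) := by
  simp only [encodePreference, List.flatMap_def, List.map_ofFn, List.cons_append,
    List.append_assoc, List.nil_append]
  rfl

theorem onesAt_encodePreference_append {m : ℕ} (p : Preference m) (w : List Γ') (j : Fin m) :
    onesAt (encodePreference p ++ w) j = p j := by
  rw [encodePreference_append, onesAt_cons (by simp), onesAt_flatMap_append_of_lt _ _ (by simp)]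
  simp

theorem onesAt_encodePreference_append_add {m : ℕ} (p : Preference m) (w : List Γ') (k : ℕ) :
    onesAt (encodePreference p ++ w) (m + k) = onesAt w k := by
  have hskip := onesAt_flatMap_append_add (List.ofFn fun j => (p j : ℕ)) (Γ'.ket :: w) k
  rw [List.length_ofFn] at hskip
  rw [encodePreference_append, onesAt_cons (by simp), hskip, onesAt_cons (by simp)]
  simp

theorem onesAt_votes_append {m n : ℕ} (V : Profile m n) (w : List Γ') (i : Fin n) (j : Fin m) :
    onesAt ((List.ofFn fun i => encodePreference (V i)).flatten ++ w) (m * i + j) = V i j := by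
  induction n with
  | zero => exact i.elim0
  | succ n ih =>
    rw [List.ofFn_succ, List.flatten_cons, List.append_assoc]
    refine Fin.cases ?_ (fun i => ?_) i
    · simpa using onesAt_encodePreference_append (V 0) _ j
    · rw [Fin.val_succ, show m * (i + 1 : ℕ) + j = m + (m * i + j) by ring,
        onesAt_encodePreference_append_add]
      exact ih (fun i => V i.succ) i

theorem describes_encodeElection_append (E : Election) (w : List Γ') :
    Describes (encodeElection E ++ w) E.tie E.votes := by
  unfold encodeElection
  rw [List.append_assoc]
  refine ⟨fun j => ?_, fun i j => ?_⟩
  · rw [entryAt, mul_zero, zero_add, onesAt_encodePreference_append]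
  · rw [entryAt, show E.numCand * (i + 1 : ℕ) + j = E.numCand + (E.numCand * i + j) by ring,
      onesAt_encodePreference_append_add, onesAt_votes_append]

theorem flatten_ofFn_eq_flatMap_range {α : Type*} {n : ℕ} {f : Fin n → List α} {g : ℕ → List α}
    (h : ∀ i, f i = g i) : (List.ofFn f).flatten = (List.range n).flatMap g := by
  rw [List.flatMap_def]
  congr 1
  exact List.ext_getElem (by simp) fun i _ _ => by simp [h]

/-- The encoding of the preference `b`, rebuilt from the entries of `w`. -/
noncomputable def preferenceWord (w : List Γ') (m b : ℕ) : List Γ' :=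
  Γ'.bra :: ((List.range m).flatMap (fun j => encodeUnary (entryAt w m b j)) ++ [Γ'.ket])

/-- The encoding of the election with `m` candidates and `n` voters, rebuilt from the entries
of `w`. -/
noncomputable def electionWord (w : List Γ') (m n : ℕ) : List Γ' :=
  preferenceWord w m 0 ++ (List.range n).flatMap fun i => preferenceWord w m (i + 1)

open Classical in
/-- The encoding of the coalition of the voters in `mem`. Each bit is written as two words of
length `0` or `1`, because only constant symbols can be repeated definably. -/
noncomputable def coalitionWord (n : ℕ) (mem : ℕ → Prop) : List Γ' :=
  (List.range n).flatMap fun i => List.replicate (if mem i then 1 else 0) (Γ'.bit true) ++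
    List.replicate (if mem i then 0 else 1) (Γ'.bit false)

theorem encodePreference_eq {m b : ℕ} {w : List Γ'} {p : Preference m}
    (h : ∀ j : Fin m, entryAt w m b j = p j) : encodePreference p = preferenceWord w m b := by
  have hcandidate : ∀ j : Fin m, encodeCandidate (p j) = encodeUnary (entryAt w m b j) :=
    fun j => by rw [h]; rfl
  rw [encodePreference, preferenceWord,
    flatten_ofFn_eq_flatMap_range (g := fun j => encodeUnary (entryAt w m b j)) hcandidate]

theorem Describes.encodeElection_eq {E : Election} {w : List Γ'}
    (h : Describes w E.tie E.votes) :
    encodeElection E = electionWord w E.numCand E.numVoters := by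
  rw [encodeElection, electionWord, encodePreference_eq h.1,
    flatten_ofFn_eq_flatMap_range (g := fun i => preferenceWord w E.numCand (i + 1))
      fun i => encodePreference_eq (h.2 i)]

theorem encodeCoalition_eq {n : ℕ} {M : Finset (Fin n)} {mem : ℕ → Prop}
    (hM : ∀ i : Fin n, mem i ↔ i ∈ M) : encodeCoalition M = coalitionWord n mem := by
  have hbits : encodeCoalition M =
      (List.ofFn fun i : Fin n => [Γ'.bit (decide (i ∈ M))]).flatten := by
    rw [← List.flatMap_singleton' (encodeCoalition M), List.flatMap_def, encodeCoalition,
      List.map_ofFn]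
    rfl
  rw [hbits]
  refine flatten_ofFn_eq_flatMap_range fun i => ?_
  by_cases hi : i ∈ M <;> simp [hM, hi]

/-- The bit of the voter `i` is set in the coalition written after the election. -/
def IsMember (w : List Γ') (m n i : ℕ) : Prop :=
  w[(electionWord w m n).length + i]? = some (Γ'.bit true)

theorem Describes.isMember_iff {E : Election} {w v : List Γ'} {M : Finset (Fin E.numVoters)}
    (h : Describes w E.tie E.votes) (hw : w = encodeElection E ++ (encodeCoalition M ++ v))
    (i : Fin E.numVoters) : IsMember w E.numCand E.numVoters i ↔ i ∈ M := by
  have hlength : (i : ℕ) < (encodeCoalition M).length := by simp [encodeCoalition]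
  rw [IsMember, ← h.encodeElection_eq, hw, List.getElem?_append_right (Nat.le_add_right _ _),
    Nat.add_sub_cancel_left, List.getElem?_append_left hlength]
  simp [encodeCoalition]

theorem le_length_flatMap_range {Γ : Type} {f : ℕ → List Γ} (hf : ∀ i, f i ≠ []) (n : ℕ) :
    n ≤ ((List.range n).flatMap f).length := by
  rw [length_flatMap_range]
  simpa using Finset.card_nsmul_le_sum (Finset.range n) (fun i => (f i).length) 1
    fun i _ => List.length_pos_iff.2 (hf i)

theorem le_length_preferenceWord (w : List Γ') (m b : ℕ) : m ≤ (preferenceWord w m b).length := by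
  have := le_length_flatMap_range (f := fun j => encodeUnary (entryAt w m b j))
    (by simp [encodeUnary]) m
  grind [preferenceWord]

theorem cand_le_length_electionWord (w : List Γ') (m n : ℕ) : m ≤ (electionWord w m n).length := by
  grind [electionWord, le_length_preferenceWord]

theorem voters_le_length_electionWord (w : List Γ') (m n : ℕ) :
    n ≤ (electionWord w m n).length := by
  have := le_length_flatMap_range (f := fun i => preferenceWord w m (i + 1))
    (by simp [preferenceWord]) n
  grind [electionWord]

/-- The numbers `f 0, …, f (m - 1)` form a preference over `m` candidates. -/
def IsRanking (m : ℕ) (f : ℕ → ℕ) : Prop :=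
  (∀ j < m, f j < m) ∧ ∀ j < m, ∀ i < j, f i ≠ f j

theorem isRanking_iff {m : ℕ} {f : ℕ → ℕ} :
    IsRanking m f ↔ ∃ p : Preference m, ∀ j : Fin m, f j = p j := by
  constructor
  · rintro ⟨hlt, hne⟩
    have hinj : Function.Injective fun j : Fin m => (⟨f j, hlt j j.2⟩ : Fin m) :=
      .of_lt_imp_ne fun i j hij heq => hne j j.2 i hij (congrArg Fin.val heq)
    exact ⟨Equiv.ofBijective _ (Finite.injective_iff_bijective.1 hinj), fun j => rfl⟩
  · rintro ⟨p, hp⟩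
    refine ⟨fun j hj => (hp ⟨j, hj⟩).trans_lt (Fin.is_lt _), fun j hj i hi hij => ?_⟩
    rw [hp ⟨j, hj⟩, hp ⟨i, hi.trans hj⟩, Fin.val_inj, p.injective.eq_iff] at hij
    exact hi.ne (congrArg Fin.val hij)

/-- The word `w` starts with the tie-breaking preference and the votes of an election with `m`
candidates and `n` voters, up to the placement of brackets, which only the comparison with
`electionWord` checks. -/
def IsElection (w : List Γ') (m n : ℕ) : Prop :=
  0 < m ∧ 0 < n ∧ ∀ b < n + 1, IsRanking m (entryAt w m b)

theorem Describes.isElection {E : Election} {w : List Γ'} (h : Describes w E.tie E.votes) :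
    IsElection w E.numCand E.numVoters := by
  refine ⟨NeZero.pos _, NeZero.pos _, fun b hb => isRanking_iff.2 ?_⟩
  cases b with
  | zero => exact ⟨_, h.1⟩
  | succ i => exact ⟨_, h.2 ⟨i, Nat.lt_of_succ_lt_succ hb⟩⟩

theorem IsElection.exists_describes {w : List Γ'} {m n : ℕ} (h : IsElection w m n) :
    ∃ E : Election, E.numCand = m ∧ E.numVoters = n ∧ Describes w E.tie E.votes := by
  obtain ⟨hm, hn, h⟩ := h
  obtain ⟨t, ht⟩ := isRanking_iff.1 (h 0 n.succ_pos)
  choose V hV using fun i : Fin n => isRanking_iff.1 (h (i + 1) (Nat.succ_lt_succ i.2))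
  exact ⟨⟨m, n, ⟨hm.ne'⟩, ⟨hn.ne'⟩, t, V⟩, rfl, rfl, ht, hV⟩

end Decoding

section Definability

variable {X : Type} [Context Γ' X] {m n b : X → ℕ}

theorem DefinableWord.encodeUnary (hb : Definable b) : DefinableWord fun c => encodeUnary (b c) :=
  (DefinableWord.replicate _ hb).append (.const _)

theorem DefinableWord.preferenceWord (hm : Definable m) (hb : Definable b) :
    DefinableWord fun c => preferenceWord (Context.word c) (m c) (b c) :=
  (DefinableWord.const [Γ'.bra]).append ((DefinableWord.flatMap hm
    (DefinableWord.encodeUnary (Definable.entryAt (X := X × ℕ) hm.fst hb.fst .snd))).append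
      (.const _))

theorem DefinableWord.electionWord (hm : Definable m) (hn : Definable n) :
    DefinableWord fun c => electionWord (Context.word c) (m c) (n c) :=
  (DefinableWord.preferenceWord hm (.const 0)).append (DefinableWord.flatMap hn
    (DefinableWord.preferenceWord (X := X × ℕ) hm.fst (Definable.snd.add .one)))

theorem DefinableWord.coalitionWord {mem : X → ℕ → Prop} (hn : Definable n)
    (hmem : DefinablePred fun c : X × ℕ => mem c.1 c.2) :
    DefinableWord fun c => coalitionWord (n c) (mem c) :=
  DefinableWord.flatMap hn ((DefinableWord.replicate _ (.ite hmem .one (.const 0))).append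
    (DefinableWord.replicate _ (.ite hmem (.const 0) .one)))

theorem DefinablePred.isMember (hm : Definable m) (hn : Definable n) :
    DefinablePred fun c : X × ℕ => IsMember (Context.word c.1) (m c.1) (n c.1) c.2 :=
  DefinablePred.sym (X := X × ℕ) _ ((DefinableWord.electionWord hm hn).length.fst.add .snd)

theorem DefinablePred.isElection (hm : Definable m) (hn : Definable n) :
    DefinablePred fun c => IsElection (Context.word c) (m c) (n c) := by
  have hentry_lt : DefinablePred fun c : (X × ℕ) × ℕ =>
      entryAt (Context.word c) (m c.1.1) c.1.2 c.2 < m c.1.1 :=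
    .lt (.entryAt hm.fst.fst Definable.snd.fst .snd) hm.fst.fst
  have hentry_ne : DefinablePred fun c : ((X × ℕ) × ℕ) × ℕ =>
      entryAt (Context.word c) (m c.1.1.1) c.1.1.2 c.2 ≠
        entryAt (Context.word c) (m c.1.1.1) c.1.1.2 c.1.2 :=
    .ne (.entryAt hm.fst.fst.fst Definable.snd.fst.fst .snd)
      (.entryAt hm.fst.fst.fst Definable.snd.fst.fst Definable.snd.fst)
  exact .and (.lt (.const 0) hm) (.and (.lt (.const 0) hn) (.forall_lt (hn.add .one)
    (.and (.forall_lt hm.fst hentry_lt) (.forall_lt hm.fst (.forall_lt .snd hentry_ne)))))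

theorem DefinablePred.exists_le_const (K : ℕ) {p : ℕ → X → Prop} (hp : ∀ k, DefinablePred (p k)) :
    DefinablePred fun c => ∃ k ≤ K, p k c := by
  induction K with
  | zero => exact (hp 0).congr fun c => by simp only [Nat.le_zero, exists_eq_left]
  | succ K ih =>
    exact (ih.or (hp (K + 1))).congr fun c => by
      simp only [Nat.le_succ_iff, or_and_right, exists_or, exists_eq_left]

end Definability

theorem inP_of_describes {P : List Γ' → Election → Prop} {Q : List Γ' → ℕ → ℕ → Prop}
    (hQ : DefinablePred fun c : (List Γ' × ℕ) × ℕ => Q c.1.1 c.1.2 c.2)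
    (hP : ∀ w E, P w E → encodeElection E <+: w)
    (hPQ : ∀ w E, Describes w E.tie E.votes → (P w E ↔ Q w E.numCand E.numVoters))
    {L : Language Γ'} (hL : ∀ w, w ∈ L ↔ ∃ E, P w E) : InP L := by
  have hdefinable : DefinablePred fun w : List Γ' => ∃ m ≤ w.length, ∃ n ≤ w.length,
      IsElection w m n ∧ Q w m n :=
    .exists_le .length_word (.exists_le Definable.length_word.fst
      ((DefinablePred.isElection (X := (List Γ' × ℕ) × ℕ) Definable.snd.fst .snd).and hQ))
  refine DefinablePred.inP (hdefinable.congr fun w => (hL w).trans ⟨?_, ?_⟩)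
  · rintro ⟨E, hE⟩
    obtain ⟨v, rfl⟩ := hP w E hE
    have hd := describes_encodeElection_append E v
    have hlength : (encodeElection E).length ≤ (encodeElection E ++ v).length :=
      (List.prefix_append _ v).length_le
    refine ⟨E.numCand, le_trans ?_ hlength, E.numVoters, le_trans ?_ hlength, hd.isElection,
      (hPQ _ E hd).1 hE⟩ <;> rw [hd.encodeElection_eq]
    · exact cand_le_length_electionWord _ _ _
    · exact voters_le_length_electionWord _ _ _
  · rintro ⟨m, -, n, -, hE, hq⟩
    obtain ⟨E, rfl, rfl, hd⟩ := hE.exists_describes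
    exact ⟨E, (hPQ w E hd).2 hq⟩

theorem Describes.exists_coalition_iff {E : Election} {w : List Γ'}
    (h : Describes w E.tie E.votes) (v : List Γ') {p : Finset (Fin E.numVoters) → Prop}
    {q : (ℕ → Prop) → Prop}
    (hpq : ∀ M mem, (∀ i : Fin E.numVoters, mem i ↔ i ∈ M) → (p M ↔ q mem)) :
    (∃ M, w = encodeElection E ++ (encodeCoalition M ++ v) ∧ p M) ↔
      w = electionWord w E.numCand E.numVoters ++
        (coalitionWord E.numVoters (IsMember w E.numCand E.numVoters) ++ v) ∧
      q (IsMember w E.numCand E.numVoters) := by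
  classical
  rw [← h.encodeElection_eq]
  constructor
  · rintro ⟨M, hw, hM⟩
    have hmem := h.isMember_iff hw
    rw [← encodeCoalition_eq hmem]
    exact ⟨hw, (hpq M _ hmem).1 hM⟩
  · rintro ⟨hw, hq⟩
    have hmem : ∀ i : Fin E.numVoters, IsMember w E.numCand E.numVoters i ↔
        i ∈ Finset.univ.filter fun i : Fin E.numVoters => IsMember w E.numCand E.numVoters i := by
      simp
    exact ⟨_, by rwa [encodeCoalition_eq hmem], (hpq _ _ hmem).2 hq⟩

theorem definableWord_electionWord :
    DefinableWord fun c : (List Γ' × ℕ) × ℕ => electionWord c.1.1 c.1.2 c.2 :=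
  DefinableWord.electionWord (X := (List Γ' × ℕ) × ℕ) Definable.snd.fst .snd

theorem definablePred_isMember :
    DefinablePred fun c : ((List Γ' × ℕ) × ℕ) × ℕ => IsMember c.1.1.1 c.1.1.2 c.1.2 c.2 :=
  DefinablePred.isMember (X := (List Γ' × ℕ) × ℕ) Definable.snd.fst .snd

theorem definableWord_coalitionWord :
    DefinableWord fun c : (List Γ' × ℕ) × ℕ => coalitionWord c.2 (IsMember c.1.1 c.1.2 c.2) :=
  .coalitionWord (mem := fun c : (List Γ' × ℕ) × ℕ => IsMember c.1.1 c.1.2 c.2) .snd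
    definablePred_isMember

theorem definablePred_coalitionAt_isMember :
    DefinablePred fun c : ((List Γ' × ℕ) × ℕ) × ℕ =>
      CoalitionAt c.1.1.1 c.1.1.2 c.1.2 c.2 (IsMember c.1.1.1 c.1.1.2 c.1.2) :=
  .coalitionAt (X := ((List Γ' × ℕ) × ℕ) × ℕ) Definable.snd.fst.fst Definable.snd.fst .snd
    (.under (p := fun c : (List Γ' × ℕ) × ℕ => IsMember c.1.1 c.1.2 c.2) definablePred_isMember)

theorem definablePred_extensionAt_empty (k : ℕ) :
    DefinablePred fun c : ((List Γ' × ℕ) × ℕ) × ℕ =>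
      ExtensionAt c.1.1.1 c.1.1.2 c.1.2 c.2 k fun _ => False :=
  .extensionAt (X := ((List Γ' × ℕ) × ℕ) × ℕ) Definable.snd.fst.fst Definable.snd.fst .snd k
    (.const False)

theorem inP_CPMW : InP (CPMW bucklin) := by
  refine inP_of_describes (P := fun w E => ∃ y : Fin E.numCand, ∃ M : Finset (Fin E.numVoters),
      w = encodeElection E ++ (encodeCoalition M ++ ([Γ'.comma] ++ encodeUnary y)) ∧
      IsPossibleCoalitionAgainst (E.rule bucklin) E.votes M y)
    (Q := fun w m n => ∃ y < m, w = electionWord w m n ++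
      (coalitionWord n (IsMember w m n) ++ ([Γ'.comma] ++ encodeUnary y)) ∧
      CoalitionAt w m n y (IsMember w m n)) ?_ ?_ ?_ fun w => ?_
  · have hword : DefinableWord fun c : ((List Γ' × ℕ) × ℕ) × ℕ =>
        electionWord c.1.1.1 c.1.1.2 c.1.2 ++
          (coalitionWord c.1.2 (IsMember c.1.1.1 c.1.1.2 c.1.2) ++
            ([Γ'.comma] ++ encodeUnary c.2)) :=
      (definableWord_electionWord.comp .fst).append ((definableWord_coalitionWord.comp .fst).append
        ((DefinableWord.const _).append (.encodeUnary .snd)))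
    exact .exists_lt Definable.snd.fst
      ((DefinablePred.word_eq .word hword).and definablePred_coalitionAt_isMember)
  · rintro w E ⟨y, M, rfl, -⟩
    exact List.prefix_append _ _
  · intro w E hd
    rw [exists_lt_iff]
    exact exists_congr fun y => hd.exists_coalition_iff _
      fun M mem hM => (hd.coalitionAt_iff (NeZero.pos _) hM y).symm
  · refine exists_congr fun E => exists_comm.trans ?_
    simp only [List.append_assoc]
    rfl

theorem inP_CPM : InP (CPM bucklin) := by
  refine inP_of_describes (P := fun w E => ∃ M : Finset (Fin E.numVoters),
      w = encodeElection E ++ (encodeCoalition M ++ []) ∧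
      IsPossibleCoalition (E.rule bucklin) E.votes M)
    (Q := fun w m n => w = electionWord w m n ++ (coalitionWord n (IsMember w m n) ++ []) ∧
      ∃ y < m, CoalitionAt w m n y (IsMember w m n)) ?_ ?_ ?_ fun w => ?_
  · exact (DefinablePred.word_eq .word (definableWord_electionWord.append
        (definableWord_coalitionWord.append (.const [])))).and
      (.exists_lt Definable.snd.fst definablePred_coalitionAt_isMember)
  · rintro w E ⟨M, rfl, -⟩
    exact List.prefix_append _ _
  · intro w E hd
    refine hd.exists_coalition_iff [] (q := fun mem => ∃ y < E.numCand, CoalitionAt w _ _ y mem)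
      fun M mem hM => ?_
    rw [exists_lt_iff]
    exact exists_congr fun y => (hd.coalitionAt_iff (NeZero.pos _) hM y).symm
  · simp only [List.append_nil]
    rfl

theorem Describes.extensionAt_empty_iff {E : Election} {w : List Γ'}
    (h : Describes w E.tie E.votes) (y : Fin E.numCand) (k : ℕ) :
    ExtensionAt w E.numCand E.numVoters y k (fun _ => False) ↔
      ∃ M : Finset (Fin E.numVoters), M.card ≤ k ∧
        IsPossibleCoalitionAgainst (E.rule bucklin) E.votes M y := by
  rw [h.extensionAt_iff (NeZero.pos _) y k (M := ∅) (by simp)]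
  simp only [Finset.empty_union]
  rfl

theorem inP_CPMSW (K : ℕ) : InP (CPMSW bucklin K) := by
  refine inP_of_describes (P := fun w E => ∃ (y : Fin E.numCand) (k : ℕ), k ≤ K ∧
      w = encodeElection E ++ encodeCandidate y ++ encodeNumber k ∧
      ∃ M : Finset (Fin E.numVoters), M.card ≤ k ∧
        IsPossibleCoalitionAgainst (E.rule bucklin) E.votes M y)
    (Q := fun w m n => ∃ y < m, ∃ k ≤ K,
      w = electionWord w m n ++ encodeUnary y ++ encodeNumber k ∧
      ExtensionAt w m n y k fun _ => False) ?_ ?_ ?_ fun _ => Iff.rfl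
  · have hword (k : ℕ) : DefinableWord fun c : ((List Γ' × ℕ) × ℕ) × ℕ =>
        electionWord c.1.1.1 c.1.1.2 c.1.2 ++ encodeUnary c.2 ++ encodeNumber k :=
      ((definableWord_electionWord.comp .fst).append (.encodeUnary .snd)).append (.const _)
    exact .exists_lt Definable.snd.fst (.exists_le_const K fun k =>
      (DefinablePred.word_eq .word (hword k)).and (definablePred_extensionAt_empty k))
  · rintro w E ⟨y, k, -, rfl, -⟩
    exact ⟨_, (List.append_assoc _ _ _).symm⟩
  · intro w E hd
    rw [exists_lt_iff]
    simp only [hd.extensionAt_empty_iff, ← hd.encodeElection_eq]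
    rfl

theorem inP_CPMS (K : ℕ) : InP (CPMS bucklin K) := by
  refine inP_of_describes (P := fun w E => ∃ k ≤ K, w = encodeElection E ++ encodeNumber k ∧
      ∃ M : Finset (Fin E.numVoters), M.card ≤ k ∧
        IsPossibleCoalition (E.rule bucklin) E.votes M)
    (Q := fun w m n => ∃ k ≤ K, w = electionWord w m n ++ encodeNumber k ∧
      ∃ y < m, ExtensionAt w m n y k fun _ => False) ?_ ?_ ?_ fun _ => Iff.rfl
  · exact .exists_le_const K fun k =>
      (DefinablePred.word_eq .word (definableWord_electionWord.append (.const _))).and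
        (.exists_lt Definable.snd.fst (definablePred_extensionAt_empty k))
  · rintro w E ⟨k, -, rfl, -⟩
    exact List.prefix_append _ _
  · intro w E hd
    refine exists_congr fun k => and_congr_right fun _ => ?_
    rw [exists_lt_iff, ← hd.encodeElection_eq]
    refine and_congr_right fun _ => ?_
    simp only [hd.extensionAt_empty_iff, IsPossibleCoalition, ← exists_and_left]
    exact exists_comm

end PossibleManipulators

theorem mainTheorem6 :
    PossibleManipulators.InP (PossibleManipulators.CPMW PossibleManipulators.bucklin) ∧
    PossibleManipulators.InP (PossibleManipulators.CPM PossibleManipulators.bucklin) ∧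
    ∀ K : ℕ,
      PossibleManipulators.InP (PossibleManipulators.CPMSW PossibleManipulators.bucklin K) ∧
      PossibleManipulators.InP (PossibleManipulators.CPMS PossibleManipulators.bucklin K) :=
  ⟨PossibleManipulators.inP_CPMW, PossibleManipulators.inP_CPM, fun K =>
    ⟨PossibleManipulators.inP_CPMSW K, PossibleManipulators.inP_CPMS K⟩⟩
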